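/- Let $k\ge 0$ be an integer, $\lambda_s,\lambda_e>0$ and $\alpha\in(0,1]$. Consider a source and $m$ receivers, and let $n=\lfloor\alpha m\rfloor$. The source is updated at the times $0<\tau_1<\tau_2<\cdots$ of a Poisson process $N_0(t)$ with rate $\lambda_s$, and the version current at time $t$ is $N_0(t)$. For every ordered pair $(i,j)$ of distinct receivers, the edge $i\to j$ is activated at the times of a Poisson process with rate $\lambda_e/(m-1)$. All these processes are mutually independent. A fixed set $\mathcal S$ of exactly $n$ receivers is the set of subscribers; at each $\tau_\ell$ the source gives each subscriber one unique key of version $\ell$, and the other receivers (nonsubscribers) get no key from the source. Nodes are memoryless: when $i\to j$ is activated at time $t$, node $i$, if it is a subscriber, sends to $j$ its own key from the source of the current version $N_0(t)$ and nothing else; a nonsubscriber sends nothing. Node $j$ can decrypt version $\ell$ as soon as it holds $k+1$ distinct keys of version $\ell$. Let $N_j^k(t)$ be the latest version that node $j$ can decrypt at time $t$ ($0$ if there is none), let $\bar A_j(k,t)=N_0(t)-N_j^k(t)$ be its $k$-keys version age, and let $$\bar\Delta_j=\lim_{t\to\infty}\frac1t\int_0^t \bar A_j(k,u)\,du .$$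 For every $m$ with $n=\lfloor\alpha m\rfloor>k$, the limit $\bar\Delta_j$ exists with probability $1$ and equals a constant $\bar\Delta_{\mathrm{sub}}(m)$ for every subscriber $j$ and a constant $\bar\Delta_{\mathrm{non}}(m)$ for every nonsubscriber $j$; for given $k,\lambda_s,\lambda_e,\alpha$ the constants depend only on $m$. Moreover, the graph average $$\bar\Delta(m)=\frac{n}{m}\,\bar\Delta_{\mathrm{sub}}(m)+\frac{m-n}{m}\,\bar\Delta_{\mathrm{non}}(m),\qquad n=\lfloor\alpha m\rfloor,$$ satisfies $$\lim_{m\to\infty}\bar\Delta(m)=\left(1+\frac{\lambda_s}{\alpha\lambda_e}\right)^k\left(\frac{\lambda_s+\alpha(\lambda_e-\lambda_s)}{\alpha\lambda_e}\right)-1 .$$ -/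

import Mathlib

open MeasureTheory ProbabilityTheory Filter Topology

namespace Gossip

/-- `gap T r` is the `r`-th interarrival time of the point process with arrival times
`T 0, T 1, T 2, …` (measured from time `0` for `r = 0`). -/
def gap {Ω : Type*} (T : ℕ → Ω → ℝ) : ℕ → Ω → ℝ
  | 0, ω => T 0 ω
  | r + 1, ω => T (r + 1) ω - T r ω

/-- `T` is the sequence of arrival times of a Poisson counter of the given rate on `[0, ∞)`:
the interarrival times are independent and exponentially distributed with parameter `rate`. -/
structure IsPoissonCounter {Ω : Type*} [MeasurableSpace Ω] (P : Measure Ω) (rate : ℝ)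
    (T : ℕ → Ω → ℝ) : Prop where
  measurable : ∀ r, Measurable (T r)
  indep : iIndepFun (gap T) P
  law : ∀ r, P.map (gap T r) = expMeasure rate

/-- The directed edges `i → j`, `i ≠ j`, of the complete directed graph on the `m` receivers. -/
abbrev Edge (m : ℕ) : Type := {e : Fin m × Fin m // e.1 ≠ e.2}

/-- The counters of the network: `none` is the counter of the source updates and `some e` is the
counter of the activations of the edge `e`. -/
abbrev Counter (m : ℕ) : Type := Option (Edge m)

/-- The rates in a scalable homogeneous network on `m` receivers with gossip rate `lamE`. -/
noncomputable def rate (m : ℕ) (lamS lamE : ℝ) : Counter m → ℝ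
  | none => lamS
  | some _ => lamE / ((m : ℝ) - 1)

/-- A scalable homogeneous network on `m` receivers: independent Poisson counters, the source
counter with rate `lamS` and every edge counter with rate `lamE / (m - 1)`. Here `T c r` is the
`r`-th arrival time (starting from `r = 0`) of the counter `c`. -/
structure IsSHN {Ω : Type*} [MeasurableSpace Ω] (P : Measure Ω) (m : ℕ) (lamS lamE : ℝ)
    (T : Counter m → ℕ → Ω → ℝ) : Prop where
  poisson : ∀ c, IsPoissonCounter P (rate m lamS lamE c) (T c)
  indep : iIndepFun (fun (c : Counter m) (ω : Ω) (r : ℕ) => T c r ω) P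

section Path

/-! In this section `x` is one realization of all the arrival times. -/

variable {m : ℕ} (x : Counter m → ℕ → ℝ)

/-- `N₀(t)`: the number of source updates up to time `t`, i.e. the current version. -/
noncomputable def sourceVersion (t : ℝ) : ℕ := {r : ℕ | x none r ≤ t}.ncard

/-- Memoryless scheme with set `S` of key holders: at time `t` node `j` holds the key of version
`l` that the source gave to node `i`. Either `i = j` and version `l` has been generated, or the
edge `i → j` was activated at some time up to `t` at which `l` was the current version of the
source (at an activation `i` sends its own source key of the current version and nothing else). -/
def HoldsKey (S : Finset (Fin m)) (l : ℕ) (i j : Fin m) (t : ℝ) : Prop :=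
  i ∈ S ∧ ((i = j ∧ l ≤ sourceVersion x t) ∨
    ∃ (h : i ≠ j) (r : ℕ), x (some ⟨(i, j), h⟩) r ≤ t ∧
      sourceVersion x (x (some ⟨(i, j), h⟩) r) = l)

/-- At time `t` node `j` can decrypt version `l`: it holds at least `k + 1` distinct keys of it. -/
def CanDecrypt (k : ℕ) (S : Finset (Fin m)) (l : ℕ) (j : Fin m) (t : ℝ) : Prop :=
  k + 1 ≤ {i : Fin m | HoldsKey x S l i j t}.ncard

/-- The latest version that node `j` can decrypt at time `t` (`0` if there is none). -/
noncomputable def decryptedVersion (k : ℕ) (S : Finset (Fin m)) (j : Fin m) (t : ℝ) : ℕ :=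
  sSup {l : ℕ | CanDecrypt x k S l j t}

/-- The `k`-keys version age of node `j` at time `t` in the memoryless scheme. -/
noncomputable def versionAge (k : ℕ) (S : Finset (Fin m)) (j : Fin m) (t : ℝ) : ℝ :=
  (sourceVersion x t : ℝ) - (decryptedVersion x k S j t : ℝ)

end Path

/-- With probability one, the time average `lim_{t → ∞} (1/t) ∫₀ᵗ` of the memoryless `k`-keys
version age of node `j` exists and equals `d`. -/
def HasTimeAverageAge {Ω : Type*} [MeasurableSpace Ω] (P : Measure Ω) {m : ℕ}
    (T : Counter m → ℕ → Ω → ℝ) (k : ℕ) (S : Finset (Fin m)) (j : Fin m) (d : ℝ) : Prop :=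
  ∀ᵐ ω ∂P,
    (∀ t : ℝ, 0 ≤ t →
      IntervalIntegrable (versionAge (fun c r => T c r ω) k S j) volume 0 t) ∧
    Tendsto (fun t : ℝ => (1 / t) * ∫ u in (0 : ℝ)..t, versionAge (fun c r => T c r ω) k S j u)
      atTop (𝓝 d)

/-- The average over the graph on `m` receivers, `n` of which are subscribers, when every
subscriber has age `dSub` and every nonsubscriber has age `dNon`. -/
noncomputable def graphAverage (m n : ℕ) (dSub dNon : ℝ) : ℝ :=
  (n : ℝ) / (m : ℝ) * dSub + ((m : ℝ) - (n : ℝ)) / (m : ℝ) * dNon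

end Gossip

namespace Gossip

/-! ### The exponential law -/

/-! Fix a node `j`. Let N be the number of subscribers other than `j` and K the number of keys `j`
must get from them: k for a subscriber, which owns one key, and k + 1 otherwise. Cut time into
epochs at the source updates. An activation transmits only the current version, so whether `j` ever
decrypts version l is settled within epoch l: at least K of the N edges into `j` must ring in it.
Hence in epoch L the age is 0 from the K-th ring on, and before that it is a_L, where a_0 = 0 and
a_{L+1} = 1 + a_L f_L with f_L the indicator that epoch L fails (`versionAge_eq`). The integral of
the age over epoch L is a_L W_L, with W_L the time spent waiting for the K-th ring
(`versionAge_epoch`).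

By memorylessness the data of an epoch are independent of the network seen from the next source
update, and that network has the original law (`map_firstEpoch_shift`). So a_L, a function of the
earlier epochs, is independent of f_L and W_L. No ergodic theorem is needed: after centering, the
terms are uncorrelated with bounded second moments, and an elementary strong law applies. It shows
that the averages of a_l W_l tend to E W / (1 - E f) (`ae_tendsto_average_runAge`). The average
epoch length tends to 1/λ, where λ is the source rate, and an interlacing argument passes from
epochs to continuous time (`timeAverage_versionAge`).

Both E f and λ E W equal the same Laplace transform, of the probability that fewer than K of N
exponential clocks of rate μ have rung. It equals 1 - p with p = ∏_{i<K} μ(N - i) / (μ(N - i) + λ):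
the K rings must each beat the source in turn (`integral_fewRingProb`). The time average is
therefore 1/p - 1 (`ae_timeAverage`).

For μ = lamE / (m - 1) and N/m → α each factor of 1/p tends to 1 + lamS / (α lamE), so 1/p tends to
its K-th power (`tendsto_winProb_inv`). Mixing K = k and K = k + 1 with weights α and 1 - α gives
the limit. -/

instance isProbabilityMeasure_expMeasure_of_fact {μ : ℝ} [Fact (0 < μ)] :
    IsProbabilityMeasure (expMeasure μ) := isProbabilityMeasure_expMeasure Fact.out

instance nullSingletonClass_expMeasure {μ : ℝ} : NullSingletonClass (expMeasure μ) :=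
  ⟨fun x => withDensity_absolutelyContinuous _ _ (measure_singleton x)⟩

theorem expMeasure_Ioi {μ : ℝ} [Fact (0 < μ)] {s : ℝ} (hs : 0 ≤ s) :
    expMeasure μ (Set.Ioi s) = ENNReal.ofReal (Real.exp (-(μ * s))) := by
  have h1 : expMeasure μ (Set.Iic s) = ENNReal.ofReal (1 - Real.exp (-(μ * s))) := by
    rw [← ofReal_cdf, cdf_expMeasure_eq Fact.out, if_pos hs]
  rw [← Set.compl_Iic, prob_compl_eq_one_sub measurableSet_Iic, h1, ← ENNReal.ofReal_one,
    ← ENNReal.ofReal_sub]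
  · congr 1; ring
  · have : 0 < μ := Fact.out
    simp only [sub_nonneg, Real.exp_le_one_iff, Left.neg_nonpos_iff]; positivity

theorem expMeasure_Ici {μ : ℝ} [Fact (0 < μ)] {s : ℝ} (hs : 0 ≤ s) :
    expMeasure μ (Set.Ici s) = ENNReal.ofReal (Real.exp (-(μ * s))) := by
  rw [← expMeasure_Ioi hs]; exact measure_congr Ioi_ae_eq_Ici.symm

theorem ae_pos_expMeasure {μ : ℝ} [Fact (0 < μ)] : ∀ᵐ a ∂expMeasure μ, 0 < a := by
  have h := expMeasure_Ioi (μ := μ) le_rfl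
  simp only [mul_zero, neg_zero, Real.exp_zero, ENNReal.ofReal_one] at h
  exact (prob_compl_eq_zero_iff measurableSet_Ioi).2 h

/-- The overshoot of an exponential variable over u, given that it reaches u, has the original law.
Two finite measures that agree on all half-lines [s, ∞) are equal, and for these the claim is the
addition law of the exponential. -/
theorem expMeasure_memoryless {μ : ℝ} [Fact (0 < μ)] {u : ℝ} (hu : 0 ≤ u) {B : Set ℝ}
    (hB : MeasurableSet B) :
    expMeasure μ {a | u ≤ a ∧ a - u ∈ B} = expMeasure μ (Set.Ici u) * expMeasure μ B := by
  have hm : Measurable (fun a : ℝ => a - u) := measurable_id.sub_const u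
  have key : ((expMeasure μ).restrict (Set.Ici u)).map (fun a => a - u)
      = expMeasure μ (Set.Ici u) • expMeasure μ := by
    have : IsFiniteMeasure (expMeasure μ (Set.Ici u) • expMeasure μ) :=
      Measure.smul_finite _ (measure_ne_top _ _)
    refine Measure.ext_of_Ici _ _ fun s => ?_
    rw [Measure.map_apply hm measurableSet_Ici, Measure.restrict_apply (hm measurableSet_Ici),
      Measure.smul_apply, smul_eq_mul]
    rcases le_or_gt 0 s with hs | hs
    · have : (fun a => a - u) ⁻¹' Set.Ici s ∩ Set.Ici u = Set.Ici (u + s) := by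
        ext a; simp only [Set.mem_inter_iff, Set.mem_preimage, Set.mem_Ici]
        constructor
        · rintro ⟨h, -⟩; linarith
        · intro h; constructor <;> linarith
      rw [this, expMeasure_Ici hu, expMeasure_Ici hs, expMeasure_Ici (add_nonneg hu hs),
        ← ENNReal.ofReal_mul (Real.exp_pos _).le, ← Real.exp_add]
      congr 2; ring
    · have h1 : (fun a => a - u) ⁻¹' Set.Ici s ∩ Set.Ici u = Set.Ici u := by
        ext a; simp only [Set.mem_inter_iff, Set.mem_preimage, Set.mem_Ici]
        constructor
        · rintro ⟨-, h⟩; exact h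
        · intro h; constructor <;> linarith
      have h2 : expMeasure μ (Set.Ici s) = 1 := by
        apply le_antisymm prob_le_one
        calc (1 : ENNReal) = expMeasure μ (Set.Ici 0) := by
              rw [expMeasure_Ici le_rfl]; simp
          _ ≤ _ := measure_mono (Set.Ici_subset_Ici.2 hs.le)
      rw [h1, h2, mul_one]
  have h := congrArg (fun ρ : Measure ℝ => ρ B) key
  simp only [Measure.smul_apply, smul_eq_mul] at h
  rw [← h, Measure.map_apply hm hB, Measure.restrict_apply (hm hB)]
  congr 1; ext a; simp [and_comm]

/-! ### The law of the gaps of a Poisson counter -/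

/-- The law of the sequence of the interarrival times of a Poisson counter. -/
noncomputable def poissonLaw (μ : ℝ) : Measure (ℕ → ℝ) := Measure.infinitePi fun _ => expMeasure μ

instance {μ : ℝ} [Fact (0 < μ)] : IsProbabilityMeasure (poissonLaw μ) := by
  unfold poissonLaw; infer_instance

/-- The sequence with first term `p.1` and tail `p.2`. -/
def cons (p : ℝ × (ℕ → ℝ)) : ℕ → ℝ
  | 0 => p.1
  | r + 1 => p.2 r

/-- The sequence without its first term. -/
def tail (h : ℕ → ℝ) : ℕ → ℝ := fun r => h (r + 1)

@[simp] theorem cons_zero (p : ℝ × (ℕ → ℝ)) : cons p 0 = p.1 := rfl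

@[simp] theorem cons_succ (p : ℝ × (ℕ → ℝ)) (r : ℕ) : cons p (r + 1) = p.2 r := rfl

@[simp] theorem tail_cons (p : ℝ × (ℕ → ℝ)) : tail (cons p) = p.2 := rfl

@[fun_prop] theorem measurable_cons : Measurable cons := by
  refine measurable_pi_iff.2 fun r => ?_
  cases r with
  | zero => exact measurable_fst
  | succ r => exact (measurable_pi_apply r).comp measurable_snd

@[fun_prop] theorem measurable_tail : Measurable tail :=
  measurable_pi_iff.2 fun r => measurable_pi_apply (r + 1)

/-- An infinite product is determined by its cylinders, and in a cylinder the factor at coordinate 0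
splits off. This allows induction by conditioning on the first gap. -/
theorem measurePreserving_cons (μ : ℝ) [Fact (0 < μ)] :
    MeasurePreserving cons ((expMeasure μ).prod (poissonLaw μ)) (poissonLaw μ) := by
  refine ⟨measurable_cons, Measure.eq_infinitePi _ fun s t ht => ?_⟩
  let s' : Finset ℕ := s.preimage Nat.succ (Nat.succ_injective.injOn)
  let t0 : Set ℝ := if 0 ∈ s then t 0 else Set.univ
  have ht0 : MeasurableSet t0 := by
    simp only [t0]; split_ifs
    · exact ht 0
    · exact MeasurableSet.univ
  rw [Measure.map_apply measurable_cons (.pi s.countable_toSet fun _ _ => ht _)]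
  have h1 : cons ⁻¹' (Set.pi (s : Set ℕ) t) = t0 ×ˢ (Set.pi (s' : Set ℕ) fun r => t (r + 1)) := by
    ext p
    simp only [Set.mem_preimage, Set.mem_pi, Finset.mem_coe, Set.mem_prod, t0, s',
      Finset.mem_preimage]
    constructor
    · intro h
      refine ⟨?_, fun r hr => h (r + 1) hr⟩
      split_ifs with h0
      · exact h 0 h0
      · trivial
    · rintro ⟨h0, h⟩ r hr
      cases r with
      | zero => rw [if_pos hr] at h0; exact h0
      | succ r => exact h r hr
  rw [h1, Measure.prod_prod, poissonLaw, Measure.infinitePi_pi _ (fun i _ => ht _)]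
  have h2 : ∏ i ∈ s', expMeasure μ (t (i + 1)) = ∏ i ∈ s.erase 0, expMeasure μ (t i) := by
    refine Finset.prod_nbij Nat.succ ?_ Nat.succ_injective.injOn ?_ ?_
    · intro i hi; simpa [s'] using hi
    · intro i hi
      simp only [Finset.coe_erase, Set.mem_sdiff, Finset.mem_coe, Set.mem_singleton_iff] at hi
      obtain ⟨r, rfl⟩ := Nat.exists_eq_succ_of_ne_zero hi.2
      exact ⟨r, by simpa [s'] using hi.1, rfl⟩
    · intros; rfl
  rw [h2]
  by_cases h0 : 0 ∈ s
  · simp only [t0, if_pos h0]; exact Finset.mul_prod_erase s (fun i => expMeasure μ (t i)) h0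
  · simp only [t0, if_neg h0, measure_univ, one_mul]; rw [Finset.erase_eq_of_notMem h0]

theorem poissonLaw_apply {μ : ℝ} [Fact (0 < μ)] {A : Set (ℕ → ℝ)} (hA : MeasurableSet A) :
    poissonLaw μ A = ∫⁻ a, poissonLaw μ {h | cons (a, h) ∈ A} ∂expMeasure μ := by
  rw [← (measurePreserving_cons μ).measure_preimage hA.nullMeasurableSet,
    Measure.prod_apply (measurable_cons hA)]
  rfl

theorem poissonLaw_apply_symm {μ : ℝ} [Fact (0 < μ)] {A : Set (ℕ → ℝ)} (hA : MeasurableSet A) :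
    poissonLaw μ A = ∫⁻ h, expMeasure μ {a | cons (a, h) ∈ A} ∂poissonLaw μ := by
  rw [← (measurePreserving_cons μ).measure_preimage hA.nullMeasurableSet,
    Measure.prod_apply_symm (measurable_cons hA)]
  rfl

/-- The head and the tail of the gaps of a Poisson counter are independent, and the tail has the
same law. -/
theorem map_head_tail_poissonLaw (μ : ℝ) [Fact (0 < μ)] :
    (poissonLaw μ).map (fun h => (h 0, tail h)) = (expMeasure μ).prod (poissonLaw μ) := by
  conv_lhs => rw [← (measurePreserving_cons μ).map_eq, Measure.map_map (by fun_prop) measurable_cons]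
  exact Measure.map_id

/-! ### Residual process after a fixed time -/

/-- The arrival times of the counter with gaps `h`. -/
def arrival (h : ℕ → ℝ) (n : ℕ) : ℝ := ∑ q ∈ Finset.range (n + 1), h q

/-- The `n`-th arrival of the counter with gaps `h` is the first one at time at least `u`. -/
def IsNext (u : ℝ) (h : ℕ → ℝ) (n : ℕ) : Prop := u ≤ arrival h n ∧ ∀ q < n, arrival h q < u

/-- The gaps, measured from time `u`, of the arrivals with index at least `n`. -/
def residualAt (n : ℕ) (u : ℝ) (h : ℕ → ℝ) : ℕ → ℝ :=
  cons (arrival h n - u, fun r => h (n + 1 + r))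

/-- The index of the first arrival at time at least `u`. -/
noncomputable def nextIndex (u : ℝ) (h : ℕ → ℝ) : ℕ := sInf {n | u ≤ arrival h n}

/-- The gaps, measured from time `u`, of the arrivals at times at least `u`. -/
noncomputable def residual (u : ℝ) (h : ℕ → ℝ) : ℕ → ℝ := residualAt (nextIndex u h) u h

theorem arrival_zero (h : ℕ → ℝ) : arrival h 0 = h 0 := by simp [arrival]

theorem arrival_succ (h : ℕ → ℝ) (n : ℕ) : arrival h (n + 1) = arrival h n + h (n + 1) := by
  simp [arrival, Finset.sum_range_succ]

theorem arrival_succ' (h : ℕ → ℝ) (n : ℕ) : arrival h (n + 1) = h 0 + arrival (tail h) n := by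
  rw [arrival, Finset.sum_range_succ', add_comm]; rfl

theorem isNext_cons_zero {u : ℝ} {p : ℝ × (ℕ → ℝ)} : IsNext u (cons p) 0 ↔ u ≤ p.1 := by
  simp [IsNext, arrival_zero]

theorem isNext_cons_succ {u : ℝ} {p : ℝ × (ℕ → ℝ)} {n : ℕ} :
    IsNext u (cons p) (n + 1) ↔ p.1 < u ∧ IsNext (u - p.1) p.2 n := by
  have h : ∀ q, arrival (cons p) (q + 1) = p.1 + arrival p.2 q := fun q => arrival_succ' _ _
  constructor
  · rintro ⟨h1, h2⟩
    rw [h] at h1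
    refine ⟨by simpa [arrival_zero] using h2 0 n.succ_pos, by linarith, fun q hq => ?_⟩
    have := h2 (q + 1) (by omega)
    rw [h] at this; linarith
  · rintro ⟨h0, h1, h2⟩
    refine ⟨by rw [h]; linarith, fun q hq => ?_⟩
    cases q with
    | zero => simpa [arrival_zero] using h0
    | succ q => have := h2 q (by omega); rw [h]; linarith

theorem residualAt_cons_zero {u : ℝ} {p : ℝ × (ℕ → ℝ)} :
    residualAt 0 u (cons p) = cons (p.1 - u, p.2) := by
  rw [residualAt, arrival_zero]
  congr 2; funext r; rw [Nat.add_comm]; rfl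

theorem residualAt_cons_succ {u : ℝ} {p : ℝ × (ℕ → ℝ)} {n : ℕ} :
    residualAt (n + 1) u (cons p) = residualAt n (u - p.1) p.2 := by
  rw [residualAt, residualAt, arrival_succ', tail_cons, cons_zero]
  congr 2
  · ring
  · funext r; rw [show n + 1 + 1 + r = (n + 1 + r) + 1 by ring]; rfl

@[fun_prop] theorem measurable_arrival (n : ℕ) : Measurable fun h : ℕ → ℝ => arrival h n := by
  unfold arrival; fun_prop

theorem measurable_residualAt (n : ℕ) :
    Measurable fun p : ℝ × (ℕ → ℝ) => residualAt n p.1 p.2 := by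
  unfold residualAt; fun_prop

theorem measurableSet_isNext (n : ℕ) :
    MeasurableSet {p : ℝ × (ℕ → ℝ) | IsNext p.1 p.2 n} := by
  have h1 : MeasurableSet {p : ℝ × (ℕ → ℝ) | p.1 ≤ arrival p.2 n} :=
    measurableSet_le measurable_fst (by fun_prop)
  have h2 : MeasurableSet {p : ℝ × (ℕ → ℝ) | ∀ q < n, arrival p.2 q < p.1} := by
    have : {p : ℝ × (ℕ → ℝ) | ∀ q < n, arrival p.2 q < p.1}
        = ⋂ q, ⋂ (_ : q < n), {p : ℝ × (ℕ → ℝ) | arrival p.2 q < p.1} := by ext; simp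
    rw [this]
    exact .iInter fun q => .iInter fun _ => measurableSet_lt (by fun_prop) measurable_fst
  exact h1.inter h2

theorem nextIndex_eq {u : ℝ} {h : ℕ → ℝ} {n : ℕ} (hn : IsNext u h n) : nextIndex u h = n := by
  refine le_antisymm (Nat.sInf_le hn.1) (le_csInf ⟨n, hn.1⟩ fun q hq => ?_)
  by_contra hlt
  exact absurd (hn.2 q (not_le.1 hlt)) (not_lt.2 hq)

theorem isNext_nextIndex {u : ℝ} {h : ℕ → ℝ} (hx : ∃ n, u ≤ arrival h n) :
    IsNext u h (nextIndex u h) :=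
  ⟨Nat.sInf_mem (s := {n | u ≤ arrival h n}) hx,
    fun _ hq => not_le.1 fun hle => Nat.notMem_of_lt_sInf hq hle⟩

theorem measurable_residual : Measurable fun p : ℝ × (ℕ → ℝ) => residual p.1 p.2 := by
  have hidx : Measurable fun p : ℝ × (ℕ → ℝ) => nextIndex p.1 p.2 := by
    have hex : MeasurableSet {p : ℝ × (ℕ → ℝ) | ∃ n, p.1 ≤ arrival p.2 n} := by
      have : {p : ℝ × (ℕ → ℝ) | ∃ n, p.1 ≤ arrival p.2 n}
        = ⋃ n, {p : ℝ × (ℕ → ℝ) | p.1 ≤ arrival p.2 n} := by ext; simp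
      rw [this]
      exact .iUnion fun _ => measurableSet_le measurable_fst (by fun_prop)
    refine measurable_to_countable' fun n => ?_
    -- The second set is the exceptional case of bounded arrival times, where `sInf ∅ = 0` puts the
    -- index at 0.
    have : (fun p : ℝ × (ℕ → ℝ) => nextIndex p.1 p.2) ⁻¹' {n}
        = {p : ℝ × (ℕ → ℝ) | IsNext p.1 p.2 n} ∪
          ({p : ℝ × (ℕ → ℝ) | ∃ n, p.1 ≤ arrival p.2 n}ᶜ ∩ {_p | n = 0}) := by
      ext p
      simp only [Set.mem_preimage, Set.mem_singleton_iff, Set.mem_union, Set.mem_ofPred_eq,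
        Set.mem_inter_iff, Set.mem_compl_iff]
      by_cases hx : ∃ n, p.1 ≤ arrival p.2 n
      · simp only [hx, not_true_eq_false, false_and, or_false]
        exact ⟨fun h => h ▸ isNext_nextIndex hx, nextIndex_eq⟩
      · have h0 : nextIndex p.1 p.2 = 0 := by
          rw [nextIndex, Nat.sInf_eq_zero]; right
          ext n; simpa using not_exists.1 hx n
        rw [h0]
        constructor
        · intro h; exact Or.inr ⟨hx, h.symm⟩
        · rintro (h | h)
          · exact absurd ⟨n, h.1⟩ hx
          · exact h.2.symm
    rw [this]
    exact (measurableSet_isNext n).union (hex.compl.inter (.const _))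
  have h2 : Measurable fun q : ℕ × (ℝ × (ℕ → ℝ)) => residualAt q.1 q.2.1 q.2.2 :=
    measurable_from_prod_countable_right fun n => measurable_residualAt n
  exact h2.comp (hidx.prodMk measurable_id)

theorem measurable_residual_right (u : ℝ) : Measurable fun h : ℕ → ℝ => residual u h := by
  have := measurable_residual.comp (measurable_prodMk_left (x := u))
  exact this

theorem measurableSet_isNext_right (u : ℝ) (n : ℕ) : MeasurableSet {h | IsNext u h n} :=
  measurableSet_preimage (measurable_prodMk_left (x := u)) (measurableSet_isNext n)

theorem measurable_residualAt_right (n : ℕ) (u : ℝ) : Measurable (residualAt n u) :=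
  Measurable.comp (g := fun p : ℝ × (ℕ → ℝ) => residualAt n p.1 p.2) (measurable_residualAt n)
    (measurable_prodMk_left (x := u))

variable {μ : ℝ} [Fact (0 < μ)]

/-- Induction on the index of the first arrival after u. If it is the very first arrival, the
exponential law is memoryless; otherwise fix the first gap a < u and apply the induction hypothesis
to the tail at time u - a. -/
theorem poissonLaw_isNext_residualAt (n : ℕ) : ∀ {u : ℝ}, 0 ≤ u → ∀ {Q : Set (ℕ → ℝ)},
    MeasurableSet Q → poissonLaw μ {h | IsNext u h n ∧ residualAt n u h ∈ Q}
      = poissonLaw μ {h | IsNext u h n} * poissonLaw μ Q := by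
  induction n with
  | zero =>
    intro u hu Q hQ
    have h1 : poissonLaw μ {h | IsNext u h 0} = expMeasure μ (Set.Ici u) := by
      rw [poissonLaw_apply_symm (measurableSet_isNext_right u 0)]
      simp only [Set.mem_ofPred_eq, isNext_cons_zero]
      simp [Set.Ici]
    have m1 : MeasurableSet {h | IsNext u h 0 ∧ residualAt 0 u h ∈ Q} :=
      (measurableSet_isNext_right u 0).inter (measurable_residualAt_right 0 u hQ)
    rw [poissonLaw_apply_symm m1, h1, poissonLaw_apply_symm hQ,
      ← lintegral_const_mul]
    · refine lintegral_congr fun h => ?_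
      have hm : MeasurableSet {a : ℝ | cons (a, h) ∈ Q} :=
        (measurable_cons.comp measurable_prodMk_right) hQ
      rw [← expMeasure_memoryless hu hm]
      simp only [Set.mem_ofPred_eq, isNext_cons_zero, residualAt_cons_zero]
    · exact measurable_measure_prodMk_right (measurable_cons hQ)
  | succ n ih =>
    intro u hu Q hQ
    have m1 : MeasurableSet {h | IsNext u h (n + 1) ∧ residualAt (n + 1) u h ∈ Q} :=
      (measurableSet_isNext_right u (n + 1)).inter (measurable_residualAt_right (n + 1) u hQ)
    rw [poissonLaw_apply m1, poissonLaw_apply (measurableSet_isNext_right u (n + 1)), ← lintegral_mul_const]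
    · refine lintegral_congr fun a => ?_
      simp only [Set.mem_ofPred_eq, isNext_cons_succ, residualAt_cons_succ]
      by_cases ha : a < u
      · simpa only [ha, true_and] using ih (sub_nonneg.2 ha.le) hQ
      · simp [ha]
    · exact measurable_measure_prodMk_left (measurable_cons (measurableSet_isNext_right u (n + 1)))

/-- The truncated first arrival adds no information about the future. For index 0 it is the constant
u; for a later index it is the first gap, and after fixing that gap the previous lemma applies to
the tail. -/
theorem poissonLaw_isNext_min_residualAt (n : ℕ) {u : ℝ} (hu : 0 ≤ u) {B : Set ℝ}
    (hB : MeasurableSet B) {Q : Set (ℕ → ℝ)} (hQ : MeasurableSet Q) :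
    poissonLaw μ {h | IsNext u h n ∧ min (h 0) u ∈ B ∧ residualAt n u h ∈ Q}
      = poissonLaw μ {h | IsNext u h n ∧ min (h 0) u ∈ B} * poissonLaw μ Q := by
  have hmin : MeasurableSet {h : ℕ → ℝ | min (h 0) u ∈ B} :=
    (Measurable.min (measurable_pi_apply 0) measurable_const) hB
  cases n with
  | zero =>
    have h0 : ∀ h : ℕ → ℝ, IsNext u h 0 → min (h 0) u = u := fun h hh => by
      have := hh.1; rw [arrival_zero] at this; exact min_eq_right this
    by_cases hB' : u ∈ B
    · have e1 : {h | IsNext u h 0 ∧ min (h 0) u ∈ B ∧ residualAt 0 u h ∈ Q}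
          = {h | IsNext u h 0 ∧ residualAt 0 u h ∈ Q} := by
        ext h
        exact ⟨fun hh => ⟨hh.1, hh.2.2⟩, fun hh => ⟨hh.1, by rw [h0 h hh.1]; exact hB', hh.2⟩⟩
      have e2 : {h | IsNext u h 0 ∧ min (h 0) u ∈ B} = {h | IsNext u h 0} := by
        ext h
        exact ⟨fun hh => hh.1, fun hh => ⟨hh, by rw [h0 h hh]; exact hB'⟩⟩
      rw [e1, e2, poissonLaw_isNext_residualAt 0 hu hQ]
    · have e1 : {h | IsNext u h 0 ∧ min (h 0) u ∈ B ∧ residualAt 0 u h ∈ Q} = ∅ := by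
        ext h
        exact ⟨fun hh => hB' (h0 h hh.1 ▸ hh.2.1), fun hh => hh.elim⟩
      have e2 : {h | IsNext u h 0 ∧ min (h 0) u ∈ B} = ∅ := by
        ext h
        exact ⟨fun hh => hB' (h0 h hh.1 ▸ hh.2), fun hh => hh.elim⟩
      rw [e1, e2]; simp
  | succ n =>
    have m1 : MeasurableSet {h | IsNext u h (n + 1) ∧ min (h 0) u ∈ B} :=
      (measurableSet_isNext_right u (n + 1)).inter hmin
    have m2 : MeasurableSet
        {h | IsNext u h (n + 1) ∧ min (h 0) u ∈ B ∧ residualAt (n + 1) u h ∈ Q} :=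
      (measurableSet_isNext_right u (n + 1)).inter
        (hmin.inter (measurable_residualAt_right (n + 1) u hQ))
    rw [poissonLaw_apply m2, poissonLaw_apply m1, ← lintegral_mul_const]
    · refine lintegral_congr fun a => ?_
      simp only [Set.mem_ofPred_eq, isNext_cons_succ, residualAt_cons_succ, cons_zero]
      by_cases ha : a < u
      · by_cases haB : min a u ∈ B
        · simpa only [ha, haB, true_and, and_true] using
            poissonLaw_isNext_residualAt n (sub_nonneg.2 ha.le) hQ
        · simp [haB]
      · simp [ha]
    · exact measurable_measure_prodMk_left (measurable_cons m1)

theorem ae_pos_poissonLaw : ∀ᵐ h ∂poissonLaw μ, ∀ n, 0 < h n := by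
  refine ae_all_iff.2 fun n => ?_
  have h := Measure.infinitePi_map_eval (fun _ : ℕ => expMeasure μ) n
  have h2 : ∀ᵐ a ∂((poissonLaw μ).map fun x => x n), 0 < a := by
    rw [poissonLaw, h]; exact ae_pos_expMeasure
  exact ae_of_ae_map (measurable_pi_apply n).aemeasurable h2

end Gossip

namespace Gossip

/-! ### Divergence of the arrival times, and the restart of a counter at a fixed time. -/

section Residual

variable {μ : ℝ} [Fact (0 < μ)]

/-- If all arrivals stay below u, then the first gap is below u and all arrivals of the tail stay
below u too. The tail is an independent copy, so the probability D satisfies D ≤ cD with c < 1,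
which forces D = 0. -/
theorem poissonLaw_bounded_eq_zero (u : ℝ) : poissonLaw μ {h | ∀ n, arrival h n < u} = 0 := by
  have hm : ∀ v : ℝ, MeasurableSet {h | ∀ n, arrival h n < v} := fun v => by
    have : {h | ∀ n, arrival h n < v} = ⋂ n, {h | arrival h n < v} := by ext; simp
    rw [this]
    exact .iInter fun n => measurableSet_lt (measurable_arrival n) measurable_const
  set D := poissonLaw μ {h | ∀ n, arrival h n < u} with hD
  have hle : D ≤ expMeasure μ (Set.Iio (max u 0)) * D := by
    rw [mul_comm, ← lintegral_indicator_const measurableSet_Iio]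
    refine (poissonLaw_apply (hm u)).le.trans ?_
    refine lintegral_mono_ae (ae_pos_expMeasure.mono fun a ha => ?_)
    by_cases hau : a < max u 0
    · rw [Set.indicator_of_mem (Set.mem_Iio.2 hau)]
      refine measure_mono fun h hh n => ?_
      have := hh (n + 1)
      rw [arrival_succ'] at this
      simp only [cons_zero, tail_cons] at this
      linarith
    · rw [Set.indicator_of_notMem (by simpa using hau), nonpos_iff_eq_zero]
      have : {h : ℕ → ℝ | cons (a, h) ∈ {h | ∀ n, arrival h n < u}} = ∅ := by
        ext h
        simp only [Set.mem_ofPred_eq, Set.mem_empty_iff_false, iff_false, not_forall]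
        refine ⟨0, ?_⟩
        rw [arrival_zero, cons_zero, not_lt]
        exact (le_max_left _ _).trans (not_lt.1 hau)
      rw [this, measure_empty]
  have hlt : expMeasure μ (Set.Iio (max u 0)) < 1 := by
    rw [← Set.compl_Ici, prob_compl_eq_one_sub measurableSet_Ici]
    refine ENNReal.sub_lt_self ENNReal.one_ne_top one_ne_zero ?_
    rw [expMeasure_Ici (le_max_right _ _)]
    simpa using Real.exp_pos _
  by_contra h0
  have hfin : D ≠ ⊤ := measure_ne_top _ _
  have : expMeasure μ (Set.Iio (max u 0)) * D < 1 * D :=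
    ENNReal.mul_lt_mul_left h0 hfin hlt
  rw [one_mul] at this
  exact absurd hle (not_le.2 this)

theorem ae_exists_le_arrival : ∀ᵐ h ∂poissonLaw μ, ∀ u : ℝ, ∃ n, u ≤ arrival h n := by
  have h1 : ∀ᵐ h ∂poissonLaw μ, ∀ k : ℕ, ∃ n, (k : ℝ) ≤ arrival h n := by
    refine ae_all_iff.2 fun k => ?_
    rw [ae_iff, ← poissonLaw_bounded_eq_zero (μ := μ) (k : ℝ)]
    simp
  filter_upwards [h1] with h hh u
  obtain ⟨k, hk⟩ := exists_nat_ge u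
  obtain ⟨n, hn⟩ := hh k
  exact ⟨n, hk.trans hn⟩

theorem poissonLaw_eq_tsum_isNext (u : ℝ) {A : Set (ℕ → ℝ)} (hA : MeasurableSet A) :
    poissonLaw μ A = ∑' n, poissonLaw μ {h | IsNext u h n ∧ h ∈ A} := by
  rw [← measure_iUnion]
  · refine measure_congr ?_
    filter_upwards [ae_exists_le_arrival (μ := μ)] with h hh
    refine propext ⟨fun hA => Set.mem_iUnion.2 ⟨nextIndex u h, isNext_nextIndex (hh u), hA⟩,
      fun hA => ?_⟩
    obtain ⟨n, hn⟩ := Set.mem_iUnion.1 hA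
    exact hn.2
  · intro i j hij
    refine Set.disjoint_left.2 fun h hi hj => hij ?_
    rw [← nextIndex_eq hi.1, nextIndex_eq hj.1]
  · exact fun n => (measurableSet_isNext_right u n).inter hA

/-- Given a time `u`, the first arrival before `u` is independent of the counter after `u`, which
is a Poisson counter again. -/
theorem map_min_residual_poissonLaw {u : ℝ} (hu : 0 ≤ u) :
    (poissonLaw μ).map (fun h => (min (h 0) u, residual u h))
      = ((poissonLaw μ).map fun h => min (h 0) u).prod (poissonLaw μ) := by
  have hmin : Measurable fun h : ℕ → ℝ => min (h 0) u :=
    Measurable.min (measurable_pi_apply 0) measurable_const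
  symm
  have : IsProbabilityMeasure ((poissonLaw μ).map fun h => min (h 0) u) :=
    Measure.isProbabilityMeasure_map hmin.aemeasurable
  refine Measure.prod_eq fun B Q hB hQ => ?_
  rw [Measure.map_apply (hmin.prodMk (measurable_residual_right u)) (hB.prod hQ),
    Measure.map_apply hmin hB, poissonLaw_eq_tsum_isNext u
      ((hmin.prodMk (measurable_residual_right u)) (hB.prod hQ)),
    poissonLaw_eq_tsum_isNext u (hmin hB), ← ENNReal.tsum_mul_right]
  refine tsum_congr fun n => ?_
  refine Eq.trans ?_ (poissonLaw_isNext_min_residualAt n hu hB hQ)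
  congr 1; ext h
  simp only [Set.mem_ofPred_eq, Set.mem_preimage, Set.mem_prod]
  refine and_congr_right fun hn => ?_
  rw [residual, nextIndex_eq hn]

end Residual

/-! ### A source counter with several edge counters -/

variable {ι : Type*}

/-- The gaps of a source counter and of the edge counters indexed by `ι`. -/
abbrev GapSpace (ι : Type*) : Type _ := (ℕ → ℝ) × (ι → ℕ → ℝ)

/-- The law of the gaps of independent Poisson counters, one source counter of rate `lam` and
edge counters of rate `μ`. -/
noncomputable def gapLaw (ι : Type*) [Fintype ι] (lam μ : ℝ) : Measure (GapSpace ι) :=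
  (poissonLaw lam).prod (Measure.pi fun _ => poissonLaw μ)

/-- The duration of the first version and the arrival times of the edges, truncated to it. -/
noncomputable def firstEpoch (x : GapSpace ι) : ℝ × (ι → ℝ) :=
  (x.1 0, fun e => min (x.2 e 0) (x.1 0))

/-- The network as seen from the first source update. -/
noncomputable def shift (x : GapSpace ι) : GapSpace ι :=
  (tail x.1, fun e => residual (x.1 0) (x.2 e))

@[fun_prop] theorem measurable_firstEpoch : Measurable (firstEpoch (ι := ι)) := by
  unfold firstEpoch; fun_prop

@[fun_prop] theorem measurable_shift : Measurable (shift (ι := ι)) := by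
  unfold shift
  refine Measurable.prodMk (by fun_prop) (measurable_pi_iff.2 fun e => ?_)
  have h : Measurable fun x : GapSpace ι => (x.1 0, x.2 e) := by fun_prop
  have := measurable_residual.comp h
  exact this

variable [Fintype ι] {lam μ : ℝ} [Fact (0 < lam)] [Fact (0 < μ)]

instance : IsProbabilityMeasure (gapLaw ι lam μ) := by unfold gapLaw; infer_instance

theorem map_min_residual_pi {u : ℝ} (hu : 0 ≤ u) :
    (Measure.pi fun _ : ι => poissonLaw μ).map
      (fun h => (fun e => min (h e 0) u, fun e => residual u (h e)))
      = ((Measure.pi fun _ : ι => poissonLaw μ).map fun h e => min (h e 0) u).prod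
        (Measure.pi fun _ : ι => poissonLaw μ) := by
  have hmin : Measurable fun h : ℕ → ℝ => min (h 0) u :=
    Measurable.min (measurable_pi_apply 0) measurable_const
  have hres := measurable_residual_right u
  have : IsProbabilityMeasure ((poissonLaw μ).map fun h => min (h 0) u) :=
    Measure.isProbabilityMeasure_map hmin.aemeasurable
  have : IsProbabilityMeasure ((poissonLaw μ).map fun h => (min (h 0) u, residual u h)) :=
    Measure.isProbabilityMeasure_map (hmin.prodMk hres).aemeasurable
  have h1 := Measure.pi_map_pi (μ := fun _ : ι => poissonLaw μ)
    (f := fun _ h => (min (h 0) u, residual u h)) (fun _ => (hmin.prodMk hres).aemeasurable)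
  have h2 := Measure.pi_map_pi (μ := fun _ : ι => poissonLaw μ)
    (f := fun _ h => min (h 0) u) (fun _ => hmin.aemeasurable)
  have h3 := (measurePreserving_arrowProdEquivProdArrow ℝ (ℕ → ℝ) ι
    (fun _ => (poissonLaw μ).map fun h => min (h 0) u) (fun _ => poissonLaw μ)).map_eq
  rw [h2, ← h3, ← map_min_residual_poissonLaw hu, ← h1, Measure.map_map]
  · rfl
  · exact MeasurableEquiv.measurable _
  · exact measurable_pi_iff.2 fun e => (hmin.prodMk hres).comp (measurable_pi_apply e)

/-- The first epoch is independent of the network as seen from the first source update, which has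
the original law. -/
theorem map_firstEpoch_shift :
    (gapLaw ι lam μ).map (fun x => (firstEpoch x, shift x))
      = ((gapLaw ι lam μ).map firstEpoch).prod (gapLaw ι lam μ) := by
  symm
  have : IsProbabilityMeasure ((gapLaw ι lam μ).map firstEpoch) :=
    Measure.isProbabilityMeasure_map measurable_firstEpoch.aemeasurable
  refine Measure.prod_eq fun B Q hB hQ => ?_
  set π := Measure.pi fun _ : ι => poissonLaw μ with hπ
  have hFm : MeasurableSet {p : ℝ × (ι → ℕ → ℝ) | (p.1, fun e => min (p.2 e 0) p.1) ∈ B} := by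
    have : Measurable fun p : ℝ × (ι → ℕ → ℝ) => (p.1, fun e => min (p.2 e 0) p.1) := by fun_prop
    exact this hB
  have hF := measurable_measure_prodMk_left (ν := π) hFm
  have hG := measurable_measure_prodMk_left (ν := π) hQ
  have e1 : gapLaw ι lam μ (firstEpoch ⁻¹' B)
      = ∫⁻ a, π (Prod.mk a ⁻¹' {p | (p.1, fun e => min (p.2 e 0) p.1) ∈ B}) ∂expMeasure lam := by
    rw [gapLaw, Measure.prod_apply (measurable_firstEpoch hB)]
    rw [← Measure.infinitePi_map_eval (fun _ : ℕ => expMeasure lam) 0,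
      lintegral_map hF (measurable_pi_apply 0)]
    rfl
  have e2 : gapLaw ι lam μ Q = ∫⁻ g, π (Prod.mk g ⁻¹' Q) ∂poissonLaw lam := by
    rw [gapLaw, Measure.prod_apply hQ]
  have hFG : Measurable fun z : ℝ × (ℕ → ℝ) =>
      π (Prod.mk z.1 ⁻¹' {p | (p.1, fun e => min (p.2 e 0) p.1) ∈ B}) * π (Prod.mk z.2 ⁻¹' Q) :=
    (hF.comp measurable_fst).mul (hG.comp measurable_snd)
  rw [Measure.map_apply (by fun_prop) (hB.prod hQ), Measure.map_apply measurable_firstEpoch hB,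
    e1, e2, ← lintegral_prod_mul hF.aemeasurable hG.aemeasurable, ← map_head_tail_poissonLaw lam,
    lintegral_map hFG (by fun_prop), gapLaw, Measure.prod_apply]
  · refine lintegral_congr_ae ?_
    -- Once the source gaps are fixed, the first update time is a deterministic nonnegative time,
    -- and the edge counters restart there independently of their truncated first arrivals.
    filter_upwards [ae_pos_poissonLaw (μ := lam)] with g hg
    have hB' : MeasurableSet {f : ι → ℝ | (g 0, f) ∈ B} := measurable_prodMk_left hB
    have hQ' : MeasurableSet {f : ι → ℕ → ℝ | (tail g, f) ∈ Q} := measurable_prodMk_left hQ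
    have h := congrArg (fun ρ => ρ ({f : ι → ℝ | (g 0, f) ∈ B} ×ˢ {f | (tail g, f) ∈ Q}))
      (map_min_residual_pi (ι := ι) (μ := μ) (hg 0).le)
    have m1 : Measurable fun h : ι → ℕ → ℝ => fun e => min (h e 0) (g 0) := by fun_prop
    have m2 : Measurable fun h : ι → ℕ → ℝ => fun e => residual (g 0) (h e) :=
      measurable_pi_iff.2 fun e => (measurable_residual_right (g 0)).comp (measurable_pi_apply e)
    simp only [Measure.prod_prod] at h
    rw [Measure.map_apply (m1.prodMk m2) (hB'.prod hQ'), Measure.map_apply m1 hB'] at h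
    exact h
  · exact (measurable_firstEpoch.prodMk measurable_shift) (hB.prod hQ)

/-! ### Regenerative systems -/

/-- Under the law `ν`, the state after one step of `θ` is independent of `V`, and it has the
original law `ν`. -/
structure IsRegenerative {X E : Type*} [MeasurableSpace X] [MeasurableSpace E] (ν : Measure X)
    (V : X → E) (θ : X → X) : Prop where
  measurable : Measurable V
  preserving : MeasurePreserving θ ν ν
  indep : IndepFun V θ ν

theorem isRegenerative_gapLaw : IsRegenerative (gapLaw ι lam μ) firstEpoch shift := by
  have : IsProbabilityMeasure ((gapLaw ι lam μ).map firstEpoch) :=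
    Measure.isProbabilityMeasure_map measurable_firstEpoch.aemeasurable
  have hp : (gapLaw ι lam μ).map shift = gapLaw ι lam μ := by
    have h := congrArg (fun ρ => Measure.map Prod.snd ρ)
      (map_firstEpoch_shift (ι := ι) (lam := lam) (μ := μ))
    rw [Measure.map_map measurable_snd (by fun_prop), Measure.map_snd_prod, measure_univ,
      one_smul] at h
    exact h
  refine ⟨measurable_firstEpoch, ⟨measurable_shift, hp⟩, ?_⟩
  rw [indepFun_iff_map_prod_eq_prod_map_map (by fun_prop) (by fun_prop), hp]
  exact map_firstEpoch_shift

namespace IsRegenerative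

variable {X E : Type*} [MeasurableSpace X] [MeasurableSpace E] {ν : Measure X}
  [IsProbabilityMeasure ν] {V : X → E} {θ : X → X}

/-- A state which is updated by `V` after every step is independent of the future. -/
theorem indepFun_state (h : IsRegenerative ν V θ) {S : Type*} [MeasurableSpace S] {s : ℕ → X → S} {Φ : ℕ → S × E → S} {c : S}
    (hΦ : ∀ l, Measurable (Φ l)) (h0 : ∀ x, s 0 x = c)
    (hs : ∀ l x, s (l + 1) x = Φ l (s l x, V (θ^[l] x))) (l : ℕ) :
    Measurable (s l) ∧ IndepFun (s l) (θ^[l]) ν := by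
  induction l with
  | zero =>
    have : s 0 = fun _ => c := funext h0
    rw [this]
    exact ⟨measurable_const, indepFun_const_left c _⟩
  | succ l ih =>
    obtain ⟨hm, hi⟩ := ih
    have hθl := h.preserving.iterate l
    have hV : Measurable fun x => V (θ^[l] x) := h.measurable.comp hθl.measurable
    have hpair : Measurable fun x => (s l x, V (θ^[l] x)) := hm.prodMk hV
    have hθl1 := (h.preserving.iterate (l + 1))
    have hVθ : Measurable fun x => (V x, θ x) := h.measurable.prodMk h.preserving.measurable
    have hind : IndepFun (fun x => (s l x, V (θ^[l] x))) (θ^[l + 1]) ν := by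
      -- Since `θ^[l]` preserves the law, the pair `(V, θ)` read after l steps is again a product.
      -- Together with the induction hypothesis the triple (state, current `V`, future) has a
      -- product law, and re-bracketing it frees the future from the first two.
      have h1 : IndepFun (s l) ((fun x => (V x, θ x)) ∘ θ^[l]) ν := hi.comp measurable_id hVθ
      have h2 := (indepFun_iff_map_prod_eq_prod_map_map hm.aemeasurable
        (hVθ.comp hθl.measurable).aemeasurable).1 h1
      rw [← Measure.map_map hVθ hθl.measurable, hθl.map_eq,
        (indepFun_iff_map_prod_eq_prod_map_map h.measurable.aemeasurable
          h.preserving.measurable.aemeasurable).1 h.indep, h.preserving.map_eq] at h2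
      have : IsProbabilityMeasure (ν.map (s l)) := Measure.isProbabilityMeasure_map hm.aemeasurable
      have : IsProbabilityMeasure (ν.map V) :=
        Measure.isProbabilityMeasure_map h.measurable.aemeasurable
      have h3 := congrArg (fun ρ => ρ.map MeasurableEquiv.prodAssoc.symm) h2
      rw [Measure.map_map (MeasurableEquiv.measurable _)
        (hm.prodMk (hVθ.comp hθl.measurable)),
        (measurePreserving_prodAssoc (ν.map (s l)) (ν.map V) ν).symm.map_eq] at h3
      have h4 : (ν.map fun x => (s l x, V (θ^[l] x))) = (ν.map (s l)).prod (ν.map V) := by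
        have := congrArg (fun ρ => ρ.map Prod.fst) h3
        rw [Measure.map_map measurable_fst, Measure.map_fst_prod, measure_univ, one_smul] at this
        · exact this
        · exact (MeasurableEquiv.measurable _).comp (hm.prodMk (hVθ.comp hθl.measurable))
      rw [indepFun_iff_map_prod_eq_prod_map_map hpair.aemeasurable hθl1.measurable.aemeasurable,
        hθl1.map_eq, h4, ← h3]
      congr 1
      funext x
      simp only [Function.comp, MeasurableEquiv.prodAssoc, Function.iterate_succ_apply']
      rfl
    have hs' : s (l + 1) = Φ l ∘ fun x => (s l x, V (θ^[l] x)) := funext (hs l)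
    rw [hs']
    exact ⟨(hΦ l).comp hpair, hind.comp (hΦ l) measurable_id⟩

end IsRegenerative

end Gossip

namespace Gossip

/-! ### A strong law of large numbers for uncorrelated sequences -/

section SLLN

variable {Ω : Type*} [MeasurableSpace Ω] {ν : Measure Ω}

/-- By Tonelli the sum of all the variables has finite expectation, so it is almost surely finite
and its terms tend to 0. -/
theorem ae_tendsto_zero_of_summable_integral {Y : ℕ → Ω → ℝ} {c : ℕ → ℝ}
    (hY : ∀ n, Integrable (Y n) ν) (h0 : ∀ n ω, 0 ≤ Y n ω) (hc : ∀ n, ∫ ω, Y n ω ∂ν ≤ c n)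
    (hs : Summable c) : ∀ᵐ ω ∂ν, Tendsto (fun n => Y n ω) atTop (𝓝 0) := by
  have hfin : ∫⁻ ω, ∑' n, ENNReal.ofReal (Y n ω) ∂ν ≠ ⊤ := by
    rw [lintegral_tsum fun n => (hY n).1.aemeasurable.ennreal_ofReal]
    refine ne_top_of_le_ne_top hs.tsum_ofReal_ne_top (ENNReal.tsum_le_tsum fun n => ?_)
    rw [← ofReal_integral_eq_lintegral_ofReal (hY n) (Eventually.of_forall (h0 n))]
    exact ENNReal.ofReal_le_ofReal (hc n)
  filter_upwards [ae_lt_top' (AEMeasurable.tsum fun n =>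
    (hY n).1.aemeasurable.ennreal_ofReal) hfin] with ω hω
  have h := ENNReal.tendsto_atTop_zero_of_tsum_ne_top hω.ne
  have h2 := (ENNReal.tendsto_toReal ENNReal.zero_ne_top).comp h
  simpa [Function.comp_def, ENNReal.toReal_ofReal (h0 _ ω)] using h2

theorem integral_sq_sum_le_of_uncorrelated {X : ℕ → Ω → ℝ} {C : ℝ} (hL : ∀ i, MemLp (X i) 2 ν)
    (hC : ∀ i, ∫ ω, X i ω ^ 2 ∂ν ≤ C) (horth : ∀ i j, i < j → ∫ ω, X i ω * X j ω ∂ν = 0)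
    (n : ℕ) : ∫ ω, (∑ i ∈ Finset.range n, X i ω) ^ 2 ∂ν ≤ C * n := by
  have hmul : ∀ i j, Integrable (fun ω => X i ω * X j ω) ν := fun i j =>
    (hL i).integrable_mul (hL j)
  have : ∀ ω, (∑ i ∈ Finset.range n, X i ω) ^ 2
      = ∑ i ∈ Finset.range n, ∑ j ∈ Finset.range n, X i ω * X j ω := fun ω => by
    rw [sq, Finset.sum_mul_sum]
  simp_rw [this]
  rw [integral_finsetSum _ fun i _ => integrable_finsetSum _ fun j _ => hmul i j]
  calc ∑ i ∈ Finset.range n, ∫ ω, ∑ j ∈ Finset.range n, X i ω * X j ω ∂ν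
      = ∑ i ∈ Finset.range n, ∫ ω, X i ω ^ 2 ∂ν := by
        refine Finset.sum_congr rfl fun i hi => ?_
        rw [integral_finsetSum _ fun j _ => hmul i j, Finset.sum_eq_single i]
        · simp_rw [sq]
        · intro j _ hji
          rcases lt_or_gt_of_ne hji with h | h
          · simp_rw [mul_comm (X i _)]; exact horth j i h
          · exact horth i j h
        · intro h; exact absurd hi h
    _ ≤ ∑ _i ∈ Finset.range n, C := Finset.sum_le_sum fun i _ => hC i
    _ = C * n := by simp [mul_comm]

theorem ae_tendsto_average_zero_of_uncorrelated {X : ℕ → Ω → ℝ} {C : ℝ}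
    (hL : ∀ i, MemLp (X i) 2 ν) (hC : ∀ i, ∫ ω, X i ω ^ 2 ∂ν ≤ C)
    (horth : ∀ i j, i < j → ∫ ω, X i ω * X j ω ∂ν = 0) :
    ∀ᵐ ω ∂ν, Tendsto (fun n : ℕ => (∑ i ∈ Finset.range n, X i ω) / n) atTop (𝓝 0) := by
  have hC0 : 0 ≤ C := (integral_nonneg fun ω => sq_nonneg (X 0 ω)).trans (hC 0)
  have hsum : Summable fun n : ℕ => 9 * C * (1 / (n : ℝ) ^ 2) :=
    (Real.summable_one_div_nat_pow.2 one_lt_two).mul_left _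
  -- Along the squares the second moment of the average is at most C / n ^ 2, which is summable.
  have hZ : ∀ᵐ ω ∂ν, Tendsto (fun n : ℕ =>
      (∑ i ∈ Finset.range (n ^ 2), X i ω) ^ 2 / (n : ℝ) ^ 4) atTop (𝓝 0) := by
    refine ae_tendsto_zero_of_summable_integral (fun n => ?_) (fun n ω => by positivity)
      (fun n => ?_) hsum
    · exact (memLp_finsetSum _ fun i _ => hL i).integrable_sq.div_const _
    · rw [integral_div]
      rcases Nat.eq_zero_or_pos n with rfl | hn
      · simp
      · have hn' : (0 : ℝ) < n := Nat.cast_pos.2 hn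
        have h := integral_sq_sum_le_of_uncorrelated hL hC horth (n ^ 2)
        push_cast at h
        rw [div_le_iff₀ (by positivity)]
        refine h.trans ?_
        have e : 9 * C * (1 / (n : ℝ) ^ 2) * n ^ 4 = 9 * (C * n ^ 2) := by field_simp
        rw [e]
        have : 0 ≤ C * (n : ℝ) ^ 2 := by positivity
        linarith
  -- Between two consecutive squares Cauchy–Schwarz bounds the squared increment by the number of
  -- terms, at most 2n + 1, times the sum of squares. The constant 9 comes from 2n + 1 ≤ 3n for n ≥
  -- 1.
  have hD : ∀ᵐ ω ∂ν, Tendsto (fun n : ℕ => (2 * (n : ℝ) + 1) *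
      (∑ i ∈ Finset.Ico (n ^ 2) ((n + 1) ^ 2), X i ω ^ 2) / (n : ℝ) ^ 4) atTop (𝓝 0) := by
    refine ae_tendsto_zero_of_summable_integral (fun n => ?_) (fun n ω => ?_)
      (fun n => ?_) hsum
    · exact ((integrable_finsetSum _ fun i _ => (hL i).integrable_sq).const_mul _).div_const _
    · have := Finset.sum_nonneg (s := Finset.Ico (n ^ 2) ((n + 1) ^ 2))
        fun i _ => sq_nonneg (X i ω)
      positivity
    · rw [integral_div, integral_const_mul, integral_finsetSum _ fun i _ => (hL i).integrable_sq]
      rcases Nat.eq_zero_or_pos n with rfl | hn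
      · simp
      · have hn' : (1 : ℝ) ≤ n := Nat.one_le_cast.2 hn
        have h : ∑ i ∈ Finset.Ico (n ^ 2) ((n + 1) ^ 2), ∫ ω, X i ω ^ 2 ∂ν
            ≤ (2 * (n : ℝ) + 1) * C := by
          refine (Finset.sum_le_sum fun i _ => hC i).trans_eq ?_
          rw [Finset.sum_const, Nat.card_Ico, nsmul_eq_mul,
            show (n + 1) ^ 2 - n ^ 2 = 2 * n + 1 by rw [Nat.sub_eq_iff_eq_add] <;> nlinarith]
          push_cast; ring
        rw [div_le_iff₀ (by positivity)]
        have e : 9 * C * (1 / (n : ℝ) ^ 2) * n ^ 4 = C * (3 * n) ^ 2 := by field_simp; ring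
        rw [e]
        calc _ ≤ (2 * (n : ℝ) + 1) * ((2 * (n : ℝ) + 1) * C) := by gcongr
          _ = C * (2 * (n : ℝ) + 1) ^ 2 := by ring
          _ ≤ _ := by gcongr; linarith
  filter_upwards [hZ, hD] with ω h1 h2
  have h3 : Tendsto (fun n : ℕ =>
      √((∑ i ∈ Finset.range (n ^ 2), X i ω) ^ 2 / (n : ℝ) ^ 4)
      + √((2 * (n : ℝ) + 1) * (∑ i ∈ Finset.Ico (n ^ 2) ((n + 1) ^ 2), X i ω ^ 2) / (n : ℝ) ^ 4))
      atTop (𝓝 0) := by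
    simpa using ((Real.continuous_sqrt.tendsto 0).comp h1).add
      ((Real.continuous_sqrt.tendsto 0).comp h2)
  have hsq : Tendsto Nat.sqrt atTop atTop :=
    tendsto_atTop.2 fun b => eventually_atTop.2 ⟨b ^ 2, fun a ha => Nat.le_sqrt'.2 ha⟩
  refine squeeze_zero_norm' ?_ (h3.comp hsq)
  filter_upwards [eventually_ge_atTop 1] with N hN
  set n := Nat.sqrt N with hn
  have hn1 : 1 ≤ n := Nat.le_sqrt'.2 (by simpa using hN)
  have hnN : n ^ 2 ≤ N := Nat.sqrt_le' N
  have hNn : N < (n + 1) ^ 2 := Nat.lt_succ_sqrt' N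
  have hn' : (0 : ℝ) < n := Nat.cast_pos.2 hn1
  have hnN' : (n : ℝ) ^ 2 ≤ N := by exact_mod_cast hnN
  have e4 : √((n : ℝ) ^ 4) = (n : ℝ) ^ 2 := by
    rw [show (n : ℝ) ^ 4 = ((n : ℝ) ^ 2) ^ 2 by ring, Real.sqrt_sq (by positivity)]
  rw [Function.comp, Real.norm_eq_abs, abs_div, Nat.abs_cast, Real.sqrt_div (by positivity),
    Real.sqrt_div' _ (by positivity), e4, Real.sqrt_sq_eq_abs, ← add_div]
  refine div_le_div₀ (by positivity) ?_ (by positivity) hnN'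
  rw [← Finset.sum_range_add_sum_Ico _ hnN]
  refine (abs_add_le _ _).trans (add_le_add_right ?_ _)
  apply Real.abs_le_sqrt
  have hc := sq_sum_le_card_mul_sum_sq (s := Finset.Ico (n ^ 2) N) (f := fun i => X i ω)
  refine hc.trans ?_
  have hcard : ((Finset.Ico (n ^ 2) N).card : ℝ) ≤ 2 * (n : ℝ) + 1 := by
    rw [Nat.card_Ico]
    have : N - n ^ 2 ≤ 2 * n + 1 := by
      rw [Nat.sub_le_iff_le_add]; nlinarith
    exact_mod_cast this
  have hsub : ∑ i ∈ Finset.Ico (n ^ 2) N, X i ω ^ 2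
      ≤ ∑ i ∈ Finset.Ico (n ^ 2) ((n + 1) ^ 2), X i ω ^ 2 :=
    Finset.sum_le_sum_of_subset_of_nonneg (Finset.Ico_subset_Ico_right hNn.le)
      fun i _ _ => sq_nonneg _
  have h0 : 0 ≤ ∑ i ∈ Finset.Ico (n ^ 2) N, X i ω ^ 2 := Finset.sum_nonneg fun i _ => sq_nonneg _
  exact mul_le_mul hcard hsub h0 (by positivity)

end SLLN

end Gossip

namespace Gossip

/-! ### Averages along a regenerative system -/

/-- The number of steps since the last one with `f = 0`, where `f` is the indicator of failure. -/
def runAge {X E : Type*} (f : E → ℝ) (V : X → E) (θ : X → X) : ℕ → X → ℝ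
  | 0, _ => 0
  | l + 1, x => 1 + runAge f V θ l x * f (V (θ^[l] x))

namespace IsRegenerative

variable {X E : Type*} [MeasurableSpace X] [MeasurableSpace E] {ν : Measure X}
  {V : X → E} {θ : X → X}

theorem integral_comp_iterate (h : IsRegenerative ν V θ) {ξ : E → ℝ} (hξ : Measurable ξ) (l : ℕ) :
    ∫ x, ξ (V (θ^[l] x)) ∂ν = ∫ x, ξ (V x) ∂ν := by
  have hp := h.preserving.iterate l
  have hm : AEStronglyMeasurable (fun x => ξ (V x)) (ν.map θ^[l]) :=
    (hξ.comp h.measurable).aestronglyMeasurable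
  rw [← integral_map hp.measurable.aemeasurable hm, hp.map_eq]

theorem memLp_comp_iterate (h : IsRegenerative ν V θ) {ξ : E → ℝ}
    (hL : MemLp (fun x => ξ (V x)) 2 ν) (l : ℕ) :
    MemLp (fun x => ξ (V (θ^[l] x))) 2 ν :=
  hL.comp_measurePreserving (h.preserving.iterate l)

variable [IsProbabilityMeasure ν]

/-- A state that depends only on past epochs, times a centered function of the current epoch,
behaves like a martingale difference: a later centered factor is independent of everything before
it, so distinct terms are uncorrelated. -/
theorem ae_tendsto_average_mul (h : IsRegenerative ν V θ) {a : ℕ → X → ℝ} {φ : ℝ × E → ℝ} {c C : ℝ}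
    (hφ : Measurable φ) (h0 : ∀ x, a 0 x = c) (hs : ∀ l x, a (l + 1) x = φ (a l x, V (θ^[l] x)))
    (ha : ∀ l, MemLp (a l) 2 ν) (hC : ∀ l, ∫ x, a l x ^ 2 ∂ν ≤ C) {ξ : E → ℝ} (hξ : Measurable ξ)
    (hL : MemLp (fun x => ξ (V x)) 2 ν) (hmean : ∫ x, ξ (V x) ∂ν = 0) :
    ∀ᵐ x ∂ν, Tendsto (fun n : ℕ => (∑ l ∈ Finset.range n, a l x * ξ (V (θ^[l] x))) / n)
      atTop (𝓝 0) := by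
  have hind : ∀ l, Measurable (a l) ∧ IndepFun (a l) (θ^[l]) ν :=
    h.indepFun_state (Φ := fun _ => φ) (fun _ => hφ) h0 hs
  have hLl := h.memLp_comp_iterate hL
  have hξm : ∀ l, Measurable fun x => ξ (V (θ^[l] x)) := fun l =>
    hξ.comp (h.measurable.comp (h.preserving.iterate l).measurable)
  have hind2 : ∀ l, IndepFun (fun x => a l x ^ 2) (fun x => ξ (V (θ^[l] x)) ^ 2) ν := fun l =>
    (hind l).2.comp (φ := fun y => y ^ 2) (ψ := fun x => ξ (V x) ^ 2) (by fun_prop)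
      ((hξ.comp h.measurable).pow_const 2)
  refine ae_tendsto_average_zero_of_uncorrelated (C := C * ∫ x, ξ (V x) ^ 2 ∂ν)
    (fun l => ?_) (fun l => ?_) (fun i j hij => ?_)
  · have hm : AEStronglyMeasurable (fun x => a l x * ξ (V (θ^[l] x))) ν :=
      ((hind l).1.mul (hξm l)).aestronglyMeasurable
    rw [memLp_two_iff_integrable_sq hm]
    simp_rw [mul_pow]
    exact (hind2 l).integrable_mul (ha l).integrable_sq (hLl l).integrable_sq
  · simp_rw [mul_pow]
    rw [(hind2 l).integral_fun_mul_eq_mul_integral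
      ((hind l).1.pow_const 2).aestronglyMeasurable ((hξm l).pow_const 2).aestronglyMeasurable,
      h.integral_comp_iterate (ξ := fun y => ξ y ^ 2) (hξ.pow_const 2)]
    exact mul_le_mul_of_nonneg_right (hC l) (integral_nonneg fun x => sq_nonneg _)
  -- The state is enlarged by a memory cell that stores the i-th product when step i is taken and
  -- keeps it afterwards. The enlarged state at time j > i is then independent of the future, so the
  -- mean-zero factor at time j splits off.
  · have key := h.indepFun_state (S := ℝ × ℝ) (c := (c, 0))
      (s := fun l x => (a l x, if i < l then a i x * ξ (V (θ^[i] x)) else 0))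
      (Φ := fun l p => (φ (p.1.1, p.2), if l = i then p.1.1 * ξ p.2 else p.1.2))
      (fun l => by
        refine Measurable.prodMk (by fun_prop) ?_
        split_ifs <;> fun_prop)
      (fun x => by simp [h0])
      (fun l x => by
        simp only [hs, Prod.mk.injEq, true_and]
        by_cases hl : l = i
        · subst hl; simp
        · rw [if_neg hl]
          have : i < l + 1 ↔ i < l := by omega
          simp [this]) j
    simp only [hij, if_true] at key
    have hi := key.2.comp (φ := fun p : ℝ × ℝ => p.2 * p.1) (ψ := fun x => ξ (V x)) (by fun_prop)
      (hξ.comp h.measurable)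
    have e : ∀ x, a i x * ξ (V (θ^[i] x)) * (a j x * ξ (V (θ^[j] x)))
        = (a i x * ξ (V (θ^[i] x)) * a j x) * ξ (V (θ^[j] x)) := fun x => by ring
    simp_rw [e]
    have := hi.integral_fun_mul_eq_mul_integral
      ((((hind i).1.mul (hξm i)).mul (hind j).1).aestronglyMeasurable)
      (hξm j).aestronglyMeasurable
    simp only [Function.comp] at this
    rw [this, h.integral_comp_iterate hξ, hmean, mul_zero]

theorem ae_tendsto_average (h : IsRegenerative ν V θ) {U : E → ℝ} (hU : Measurable U)
    (hL : MemLp (fun x => U (V x)) 2 ν) :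
    ∀ᵐ x ∂ν, Tendsto (fun n : ℕ => (∑ l ∈ Finset.range n, U (V (θ^[l] x))) / n) atTop
      (𝓝 (∫ x, U (V x) ∂ν)) := by
  set u := ∫ x, U (V x) ∂ν
  have hmean : ∫ x, (U (V x) - u) ∂ν = 0 := by
    rw [integral_sub (hL.integrable one_le_two) (integrable_const _)]; simp [u]
  have := h.ae_tendsto_average_mul (a := fun _ _ => 1) (φ := fun _ => 1) (c := 1) (C := 1)
    measurable_const (fun _ => rfl) (fun _ _ => rfl) (fun _ => memLp_const _) (by simp)
    (ξ := fun y => U y - u) (hU.sub_const u) (hL.sub (memLp_const u)) hmean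
  filter_upwards [this] with x hx
  have h2 := hx.add_const u
  rw [zero_add] at h2
  refine h2.congr' ?_
  filter_upwards [eventually_ge_atTop 1] with n hn
  have hn' : (n : ℝ) ≠ 0 := Nat.cast_ne_zero.2 (by omega)
  simp only [one_mul, Finset.sum_sub_distrib, Finset.sum_const, Finset.card_range, nsmul_eq_mul]
  field_simp
  ring

/-- The averages of a reward `W`, weighted with the number of steps since the last success. -/
theorem ae_tendsto_average_runAge (h : IsRegenerative ν V θ) {f W : E → ℝ} (hf : Measurable f)
    (hf0 : ∀ y, 0 ≤ f y) (hf1 : ∀ y, f y ≤ 1) (hq : ∫ x, f (V x) ∂ν < 1) (hW : Measurable W)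
    (hL : MemLp (fun x => W (V x)) 2 ν) :
    ∀ᵐ x ∂ν, Tendsto
      (fun n : ℕ => (∑ l ∈ Finset.range n, runAge f V θ l x * W (V (θ^[l] x))) / n) atTop
      (𝓝 ((∫ x, W (V x) ∂ν) / (1 - ∫ x, f (V x) ∂ν))) := by
  set q := ∫ x, f (V x) ∂ν with hqdef
  set w := ∫ x, W (V x) ∂ν with hw
  set a := runAge f V θ with ha
  have hq0 : 0 ≤ q := integral_nonneg fun x => hf0 _
  have h0 : ∀ x, a 0 x = 0 := fun _ => rfl
  let φ : ℝ × E → ℝ := fun p => 1 + p.1 * f p.2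
  have hφ : Measurable φ := by fun_prop
  have hs : ∀ l x, a (l + 1) x = φ (a l x, V (θ^[l] x)) := fun _ _ => rfl
  have hind : ∀ l, Measurable (a l) ∧ IndepFun (a l) (θ^[l]) ν :=
    h.indepFun_state (Φ := fun _ => φ) (fun _ => hφ) h0 hs
  have hbd : ∀ l x, 0 ≤ a l x ∧ a l x ≤ l := by
    intro l
    induction l with
    | zero => intro x; simp [h0]
    | succ l ih =>
      intro x
      obtain ⟨h1, h2⟩ := ih x
      have := hf0 (V (θ^[l] x)); have := hf1 (V (θ^[l] x))
      rw [hs]; simp only [φ]; push_cast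
      constructor <;> nlinarith
  have haL : ∀ l, MemLp (a l) 2 ν := fun l =>
    MemLp.of_bound (hind l).1.aestronglyMeasurable l (Eventually.of_forall fun x => by
      rw [Real.norm_of_nonneg (hbd l x).1]; exact (hbd l x).2)
  have hfm : ∀ l, Measurable fun x => f (V (θ^[l] x)) := fun l =>
    hf.comp (h.measurable.comp (h.preserving.iterate l).measurable)
  have hfL : MemLp (fun x => f (V x)) 2 ν :=
    MemLp.of_bound (hf.comp h.measurable).aestronglyMeasurable 1 (Eventually.of_forall fun x => by
      rw [Real.norm_of_nonneg (hf0 _)]; exact hf1 _)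
  have hfi : ∀ l, Integrable (fun x => f (V (θ^[l] x))) ν := fun l =>
    (h.memLp_comp_iterate hfL l).integrable one_le_two
  have hi1 : ∀ l, IndepFun (a l) (fun x => f (V (θ^[l] x))) ν := fun l =>
    (hind l).2.comp (φ := id) (ψ := fun x => f (V x)) measurable_id (hf.comp h.measurable)
  have hi2 : ∀ l, IndepFun (fun x => a l x ^ 2) (fun x => f (V (θ^[l] x))) ν := fun l =>
    (hind l).2.comp (φ := fun y => y ^ 2) (ψ := fun x => f (V x)) (by fun_prop)
      (hf.comp h.measurable)
  -- By independence the expectations obey x ↦ 1 + q x, and 1 / (1 - q) is its fixed point.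
  have hE1 : ∀ l, ∫ x, a l x ∂ν ≤ 1 / (1 - q) := by
    intro l
    induction l with
    | zero => simp only [h0, integral_zero]; exact div_nonneg zero_le_one (by linarith)
    | succ l ih =>
      have e : ∫ x, a (l + 1) x ∂ν = 1 + (∫ x, a l x ∂ν) * q := by
        simp only [hs, φ]
        have hint : Integrable (fun x => a l x * f (V (θ^[l] x))) ν :=
          (hi1 l).integrable_mul ((haL l).integrable one_le_two) (hfi l)
        rw [integral_add (integrable_const _) hint,
          (hi1 l).integral_fun_mul_eq_mul_integral (hind l).1.aestronglyMeasurable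
          (hfm l).aestronglyMeasurable, h.integral_comp_iterate hf]
        simp [hqdef]
      rw [e]
      calc 1 + (∫ x, a l x ∂ν) * q ≤ 1 + 1 / (1 - q) * q := by gcongr
        _ = 1 / (1 - q) := by
          have : 1 - q ≠ 0 := by linarith
          field_simp; ring
  -- The fixed point of the recursion for the second moments, C = 1 + 2q / (1 - q) + qC. The bound f
  -- ^ 2 ≤ f makes that recursion linear in q.
  set C := (1 + 2 * (1 / (1 - q) * q)) / (1 - q) with hCdef
  have hC0 : 0 ≤ C := div_nonneg (add_nonneg zero_le_one (mul_nonneg zero_le_two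
    (mul_nonneg (div_nonneg zero_le_one (by linarith)) hq0))) (by linarith)
  have hE2 : ∀ l, ∫ x, a l x ^ 2 ∂ν ≤ C := by
    intro l
    induction l with
    | zero => simpa [h0] using hC0
    | succ l ih =>
      have hint1 : Integrable (fun x => a l x * f (V (θ^[l] x))) ν :=
        (hi1 l).integrable_mul ((haL l).integrable one_le_two) (hfi l)
      have hint2 : Integrable (fun x => a l x ^ 2 * f (V (θ^[l] x))) ν :=
        (hi2 l).integrable_mul (haL l).integrable_sq (hfi l)
      have hint3 : Integrable (fun x => 1 + 2 * (a l x * f (V (θ^[l] x)))) ν :=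
        (integrable_const _).add (hint1.const_mul 2)
      have e : ∫ x, a (l + 1) x ^ 2 ∂ν
          ≤ ∫ x, (1 + 2 * (a l x * f (V (θ^[l] x))) + a l x ^ 2 * f (V (θ^[l] x))) ∂ν := by
        refine integral_mono (haL (l + 1)).integrable_sq
          (hint3.add hint2) fun x => ?_
        have := hf0 (V (θ^[l] x)); have := hf1 (V (θ^[l] x))
        have h3 : f (V (θ^[l] x)) ^ 2 ≤ f (V (θ^[l] x)) := by nlinarith
        simp only [hs, φ]
        nlinarith [mul_le_mul_of_nonneg_left h3 (sq_nonneg (a l x))]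
      refine e.trans ?_
      rw [integral_add hint3 hint2,
        integral_add (integrable_const _) (hint1.const_mul 2), integral_const_mul,
        (hi1 l).integral_fun_mul_eq_mul_integral (hind l).1.aestronglyMeasurable
          (hfm l).aestronglyMeasurable,
        (hi2 l).integral_fun_mul_eq_mul_integral ((hind l).1.pow_const 2).aestronglyMeasurable
          (hfm l).aestronglyMeasurable, h.integral_comp_iterate hf]
      simp only [integral_const, probReal_univ, smul_eq_mul, mul_one]
      calc 1 + 2 * ((∫ x, a l x ∂ν) * q) + (∫ x, a l x ^ 2 ∂ν) * q
          ≤ 1 + 2 * (1 / (1 - q) * q) + C * q := by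
            gcongr
            exact hE1 l
        _ = C := by
          have : 1 - q ≠ 0 := by linarith
          rw [hCdef]; field_simp; ring
  have hfmean : ∫ x, (f (V x) - q) ∂ν = 0 := by
    rw [integral_sub (hfL.integrable one_le_two) (integrable_const _)]; simp [hqdef]
  have hWmean : ∫ x, (W (V x) - w) ∂ν = 0 := by
    rw [integral_sub (hL.integrable one_le_two) (integrable_const _)]; simp [hw]
  have t1 := h.ae_tendsto_average_mul hφ h0 hs haL hE2 (ξ := fun y => f y - q) (hf.sub_const q)
    (hfL.sub (memLp_const q)) hfmean
  have t2 := h.ae_tendsto_average_mul hφ h0 hs haL hE2 (ξ := fun y => W y - w) (hW.sub_const w)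
    (hL.sub (memLp_const w)) hWmean
  have t3 : ∀ᵐ x ∂ν, Tendsto (fun l : ℕ => a l x ^ 2 / (l : ℝ) ^ 2) atTop (𝓝 0) := by
    refine ae_tendsto_zero_of_summable_integral (c := fun l => C * (1 / (l : ℝ) ^ 2))
      (fun l => (haL l).integrable_sq.div_const _) (fun l x => by positivity) (fun l => ?_)
      ((Real.summable_one_div_nat_pow.2 one_lt_two).mul_left _)
    rw [integral_div, mul_one_div]
    exact div_le_div_of_nonneg_right (hE2 l) (by positivity)
  filter_upwards [t1, t2, t3] with x h1 h2 h3
  have h4 : Tendsto (fun l : ℕ => a l x / l) atTop (𝓝 0) := by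
    have := (Real.continuous_sqrt.tendsto 0).comp h3
    rw [Real.sqrt_zero] at this
    refine this.congr fun l => ?_
    rw [Function.comp, ← div_pow, Real.sqrt_sq (div_nonneg (hbd l x).1 (Nat.cast_nonneg l))]
  -- The recursion summed over l, with f split into its mean q and a centered part. After division
  -- by n the boundary term and the centered sum vanish in the limit, leaving A = 1 + qA for the
  -- average A.
  have hsum : ∀ n : ℕ, a n x + ∑ l ∈ Finset.range n, a l x
      = n + q * (∑ l ∈ Finset.range n, a l x)
        + ∑ l ∈ Finset.range n, a l x * (f (V (θ^[l] x)) - q) := by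
    intro n
    induction n with
    | zero => simp [h0]
    | succ n ih =>
      rw [Finset.sum_range_succ, Finset.sum_range_succ, hs]
      simp only [φ]; push_cast
      linarith
  have hq1 : 1 - q ≠ 0 := by linarith
  have hA : Tendsto (fun n : ℕ => (∑ l ∈ Finset.range n, a l x) / n) atTop (𝓝 (1 / (1 - q))) := by
    have h5 : Tendsto (fun n : ℕ =>
        (1 + (∑ l ∈ Finset.range n, a l x * (f (V (θ^[l] x)) - q)) / n - a n x / n) / (1 - q))
        atTop (𝓝 ((1 + 0 - 0) / (1 - q))) := ((h1.const_add 1).sub h4).div_const _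
    rw [add_zero, sub_zero] at h5
    refine h5.congr' ?_
    filter_upwards [eventually_ge_atTop 1] with n hn
    have hn' : (n : ℝ) ≠ 0 := Nat.cast_ne_zero.2 (by omega)
    have := hsum n
    field_simp
    linarith
  have h6 := h2.add (hA.const_mul w)
  rw [zero_add, mul_one_div] at h6
  refine h6.congr fun n => ?_
  rw [← mul_div_assoc, ← add_div]
  congr 1
  simp_rw [mul_sub]
  rw [Finset.sum_sub_distrib, ← Finset.sum_mul]
  ring

end IsRegenerative

end Gossip

namespace Gossip

/-! ### The race between the edges and the source -/

/-- The probability that exactly `i` of `N` independent exponential clocks of rate `μ` ring up to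
time `s`. -/
noncomputable def ringProb (N : ℕ) (μ : ℝ) (i : ℕ) (s : ℝ) : ℝ :=
  (N.choose i : ℝ) * (1 - Real.exp (-(μ * s))) ^ i * Real.exp (-(μ * s)) ^ (N - i)

/-- The probability that less than `K` of `N` independent exponential clocks of rate `μ` ring up to
time `s`. -/
noncomputable def fewRingProb (N K : ℕ) (μ : ℝ) (s : ℝ) : ℝ :=
  ∑ i ∈ Finset.range K, ringProb N μ i s

theorem continuous_ringProb (N : ℕ) (μ : ℝ) (i : ℕ) : Continuous (ringProb N μ i) := by
  unfold ringProb; fun_prop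

theorem exp_neg_mul_mem_Icc {μ s : ℝ} (hμ : 0 < μ) (hs : 0 ≤ s) :
    0 ≤ Real.exp (-(μ * s)) ∧ Real.exp (-(μ * s)) ≤ 1 :=
  ⟨(Real.exp_pos _).le, by
    rw [Real.exp_le_one_iff, Left.neg_nonpos_iff]; positivity⟩

theorem ringProb_nonneg (N : ℕ) {μ : ℝ} (hμ : 0 < μ) (i : ℕ) {s : ℝ} (hs : 0 ≤ s) :
    0 ≤ ringProb N μ i s := by
  obtain ⟨h0, h1⟩ := exp_neg_mul_mem_Icc hμ hs
  have : 0 ≤ 1 - Real.exp (-(μ * s)) := by linarith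
  unfold ringProb; positivity

theorem ringProb_le (N : ℕ) {μ : ℝ} (hμ : 0 < μ) (i : ℕ) {s : ℝ} (hs : 0 ≤ s) :
    ringProb N μ i s ≤ N.choose i := by
  obtain ⟨h0, h1⟩ := exp_neg_mul_mem_Icc hμ hs
  have h2 : 0 ≤ 1 - Real.exp (-(μ * s)) := by linarith
  unfold ringProb
  calc (N.choose i : ℝ) * (1 - Real.exp (-(μ * s))) ^ i * Real.exp (-(μ * s)) ^ (N - i)
      ≤ N.choose i * 1 * 1 := by
        gcongr
        · exact pow_le_one₀ h2 (by linarith)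
        · exact pow_le_one₀ h0 h1
    _ = _ := by ring

variable {lam μ : ℝ}

theorem integrableOn_exp_mul_ringProb (hl : 0 < lam) (hμ : 0 < μ) (N i : ℕ) :
    IntegrableOn (fun s => Real.exp (-(lam * s)) * ringProb N μ i s) (Set.Ioi 0) := by
  have hg : IntegrableOn (fun s => Real.exp (-lam * s) * (N.choose i : ℝ)) (Set.Ioi 0) :=
    (exp_neg_integrableOn_Ioi 0 hl).mul_const _
  refine Integrable.mono' hg ?_ ?_
  · exact (Continuous.mul (by fun_prop) (continuous_ringProb N μ i)).aestronglyMeasurable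
  · refine (ae_restrict_iff' measurableSet_Ioi).2 (Eventually.of_forall fun s hs => ?_)
    have hs' : (0 : ℝ) ≤ s := le_of_lt hs
    rw [Real.norm_of_nonneg (mul_nonneg (Real.exp_pos _).le (ringProb_nonneg N hμ i hs')), neg_mul]
    exact mul_le_mul_of_nonneg_left (ringProb_le N hμ i hs') (Real.exp_pos _).le

theorem tendsto_exp_mul_ringProb (hl : 0 < lam) (hμ : 0 < μ) (N i : ℕ) :
    Tendsto (fun s => Real.exp (-(lam * s)) * ringProb N μ i s) atTop (𝓝 0) := by
  have h1 : Tendsto (fun s => Real.exp (-(lam * s)) * (N.choose i : ℝ)) atTop (𝓝 0) := by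
    rw [← zero_mul (N.choose i : ℝ)]
    exact (Real.tendsto_exp_neg_atTop_nhds_zero.comp
      (tendsto_id.const_mul_atTop hl)).mul_const _
  refine squeeze_zero' ?_ ?_ h1
  · filter_upwards [eventually_ge_atTop 0] with s hs
    exact mul_nonneg (Real.exp_pos _).le (ringProb_nonneg N hμ i hs)
  · filter_upwards [eventually_ge_atTop 0] with s hs
    exact mul_le_mul_of_nonneg_left (ringProb_le N hμ i hs) (Real.exp_pos _).le

theorem hasDerivAt_exp_neg_mul (a s : ℝ) :
    HasDerivAt (fun s => Real.exp (-(a * s))) (-(a * Real.exp (-(a * s)))) s := by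
  have h := ((hasDerivAt_id s).const_mul a).fun_neg.exp
  simp only [id, mul_one] at h
  exact h.congr_deriv (by ring)

theorem hasDerivAt_ringProb_zero (N : ℕ) (s : ℝ) :
    HasDerivAt (ringProb N μ 0) (-(μ * N * ringProb N μ 0 s)) s := by
  have e : ringProb N μ 0 = fun s => Real.exp (-(μ * N * s)) := by
    funext s; simp only [ringProb, Nat.choose_zero_right, Nat.cast_one, pow_zero, one_mul,
      Nat.sub_zero, ← Real.exp_nat_mul]
    congr 1; ring
  rw [e]
  exact hasDerivAt_exp_neg_mul (μ * N) s

/-- The forward equation of the pure birth process that counts the clocks that have rung: from state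
i it jumps at rate μ(N - i). -/
theorem hasDerivAt_ringProb_succ {N i : ℕ} (hi : i + 1 ≤ N) (s : ℝ) :
    HasDerivAt (ringProb N μ (i + 1))
      (μ * (N - i) * ringProb N μ i s - μ * (N - (i + 1 : ℕ)) * ringProb N μ (i + 1) s) s := by
  obtain ⟨M, rfl⟩ := Nat.exists_eq_add_of_le hi
  have hE := hasDerivAt_exp_neg_mul μ s
  have h1 := ((hE.const_sub 1).fun_pow (i + 1)).const_mul (((i + 1 + M).choose (i + 1) : ℕ) : ℝ)
  have h2 := h1.fun_mul (hE.fun_pow M)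
  have hc : (((i + 1 + M).choose (i + 1) : ℕ) : ℝ) * (i + 1) = (i + 1 + M).choose i * (M + 1) := by
    have := Nat.choose_succ_right_eq (i + 1 + M) i
    rw [show i + 1 + M - i = M + 1 by omega] at this
    exact_mod_cast this
  have e1 : i + 1 + M - (i + 1) = M := by omega
  have e2 : i + 1 + M - i = M + 1 := by omega
  have e : ringProb (i + 1 + M) μ (i + 1) = fun s =>
      (((i + 1 + M).choose (i + 1) : ℕ) : ℝ) * (1 - Real.exp (-(μ * s))) ^ (i + 1)
        * Real.exp (-(μ * s)) ^ M := by funext s; rw [ringProb, e1]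
  rw [e]
  refine HasDerivAt.congr_deriv h2 ?_
  simp only [ringProb, e2]
  set x := Real.exp (-(μ * s))
  push_cast
  have hc' : ∀ y : ℝ, (((i + 1 + M).choose (i + 1) : ℕ) : ℝ) * ((i + 1) * y)
      = (i + 1 + M).choose i * (M + 1) * y := fun y => by rw [← mul_assoc, hc]
  -- The case M = 0 is separate because differentiating the M-th power produces the truncated
  -- exponent M - 1.
  rcases M with _ | M
  · simp only [pow_zero, Nat.cast_zero]
    linear_combination hc' ((1 - x) ^ i * μ * x)
  · simp only [Nat.add_sub_cancel]
    push_cast at hc' ⊢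
    linear_combination hc' ((1 - x) ^ i * μ * x * x ^ (M + 1))

theorem mul_integral_ringProb_zero (hl : 0 < lam) (hμ : 0 < μ) (N : ℕ) :
    (lam + μ * N) * ∫ s in Set.Ioi 0, Real.exp (-(lam * s)) * ringProb N μ 0 s = 1 := by
  have h := integral_Ioi_of_hasDerivAt_of_tendsto' (a := 0) (m := 0)
    (f := fun s => Real.exp (-(lam * s)) * ringProb N μ 0 s)
    (f' := fun s => -(lam + μ * N) * (Real.exp (-(lam * s)) * ringProb N μ 0 s))
    (fun s _ => by
      refine ((hasDerivAt_exp_neg_mul lam s).mul (hasDerivAt_ringProb_zero N s)).congr_deriv ?_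
      ring)
    ((integrableOn_exp_mul_ringProb hl hμ N 0).const_mul _) (tendsto_exp_mul_ringProb hl hμ N 0)
  rw [integral_const_mul] at h
  simp [ringProb] at h ⊢
  linarith

/-- The Laplace transform at `lam` of the forward equation. The boundary terms vanish: at infinity
by the exponential weight, and at 0 because no clock has rung yet. -/
theorem mul_integral_ringProb_succ (hl : 0 < lam) (hμ : 0 < μ) {N i : ℕ} (hi : i + 1 ≤ N) :
    (lam + μ * (N - (i + 1 : ℕ))) *
      ∫ s in Set.Ioi 0, Real.exp (-(lam * s)) * ringProb N μ (i + 1) s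
      = μ * (N - i) * ∫ s in Set.Ioi 0, Real.exp (-(lam * s)) * ringProb N μ i s := by
  have hi1 := (integrableOn_exp_mul_ringProb hl hμ N i).const_mul (μ * (N - i))
  have hi2 := (integrableOn_exp_mul_ringProb hl hμ N (i + 1)).const_mul
    (lam + μ * (N - (i + 1 : ℕ)))
  have h := integral_Ioi_of_hasDerivAt_of_tendsto' (a := 0) (m := 0)
    (f := fun s => Real.exp (-(lam * s)) * ringProb N μ (i + 1) s)
    (f' := fun s => μ * (N - i) * (Real.exp (-(lam * s)) * ringProb N μ i s)
      - (lam + μ * (N - (i + 1 : ℕ))) * (Real.exp (-(lam * s)) * ringProb N μ (i + 1) s))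
    (fun s _ => by
      refine ((hasDerivAt_exp_neg_mul lam s).mul (hasDerivAt_ringProb_succ hi s)).congr_deriv ?_
      ring)
    (hi1.sub hi2) (tendsto_exp_mul_ringProb hl hμ N (i + 1))
  rw [integral_sub hi1 hi2, integral_const_mul, integral_const_mul] at h
  have h0 : ringProb N μ (i + 1) 0 = 0 := by simp [ringProb]
  rw [h0, mul_zero, sub_zero] at h
  linarith

/-- The probability that `K` of `N` independent exponential clocks of rate `μ` ring before an
independent exponential clock of rate `lam`. -/
noncomputable def winProb (lam μ : ℝ) (N K : ℕ) : ℝ :=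
  ∏ i ∈ Finset.range K, (1 + lam / (μ * (N - i)))⁻¹

theorem integral_ringProb (hl : 0 < lam) (hμ : 0 < μ) (N : ℕ) : ∀ i ≤ N,
    (∫ s in Set.Ioi 0, Real.exp (-(lam * s)) * ringProb N μ i s)
      = winProb lam μ N i / (lam + μ * (N - i)) := by
  intro i
  induction i with
  | zero =>
    intro _
    have h := mul_integral_ringProb_zero hl hμ N
    have : 0 < lam + μ * N := by positivity
    rw [eq_div_iff (by simpa using this.ne')]
    simp only [winProb, Finset.range_zero, Finset.prod_empty, Nat.cast_zero, sub_zero]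
    linarith
  | succ i ih =>
    intro hi
    have h := mul_integral_ringProb_succ hl hμ hi
    have h1 : (0 : ℝ) ≤ N - (i + 1 : ℕ) := sub_nonneg.2 (Nat.cast_le.2 hi)
    have h2 : (0 : ℝ) < N - i := by push_cast at h1; linarith
    have h3 : 0 < lam + μ * (N - (i + 1 : ℕ)) := by positivity
    rw [eq_div_iff h3.ne', mul_comm, h, ih (by omega), winProb, winProb, Finset.prod_range_succ]
    have h4 : 0 < lam + μ * (N - i) := by positivity
    have h5 : (1 + lam / (μ * (N - i)))⁻¹ = μ * (N - i) / (lam + μ * (N - i)) := by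
      rw [← one_div, div_eq_div_iff (by positivity) h4.ne']; field_simp; ring
    rw [h5]; ring

/-- Multiplied by `lam`, the i-th transform is the difference of the win probabilities for i and i +
1 rings, so the sum over i < K telescopes. -/
theorem integral_fewRingProb (hl : 0 < lam) (hμ : 0 < μ) (N : ℕ) : ∀ K ≤ N,
    lam * (∫ s in Set.Ioi 0, Real.exp (-(lam * s)) * fewRingProb N K μ s)
      = 1 - winProb lam μ N K := by
  intro K hK
  have hsplit : ∀ s, Real.exp (-(lam * s)) * fewRingProb N K μ s
      = ∑ i ∈ Finset.range K, Real.exp (-(lam * s)) * ringProb N μ i s := fun s => by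
    rw [fewRingProb, Finset.mul_sum]
  simp_rw [hsplit]
  rw [integral_finsetSum _ fun i _ => integrableOn_exp_mul_ringProb hl hμ N i]
  induction K with
  | zero => simp [winProb]
  | succ K ih =>
    have h := ih (by omega) (fun s => by rw [fewRingProb, Finset.mul_sum])
    rw [Finset.sum_range_succ, mul_add, h, integral_ringProb hl hμ N K (by omega), winProb,
      winProb, Finset.prod_range_succ]
    have h2 : (0 : ℝ) < N - K := sub_pos.2 (Nat.cast_lt.2 hK)
    have h4 : 0 < lam + μ * (N - K) := by positivity
    have h5 : (1 + lam / (μ * (N - K)))⁻¹ = 1 - lam / (lam + μ * (N - K)) := by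
      rw [← one_div, one_sub_div h4.ne', div_eq_div_iff (by positivity) h4.ne']; field_simp; ring
    rw [h5]; ring

theorem winProb_pos (hl : 0 < lam) (hμ : 0 < μ) {N K : ℕ} (hK : K ≤ N) : 0 < winProb lam μ N K := by
  refine Finset.prod_pos fun i hi => ?_
  have h2 : (0 : ℝ) < N - i := sub_pos.2 (Nat.cast_lt.2 ((Finset.mem_range.1 hi).trans_le hK))
  positivity

theorem fewRingProb_nonneg (hμ : 0 < μ) (N K : ℕ) {s : ℝ} (hs : 0 ≤ s) :
    0 ≤ fewRingProb N K μ s := Finset.sum_nonneg fun i _ => ringProb_nonneg N hμ i hs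

theorem integrableOn_exp_mul_fewRingProb (hl : 0 < lam) (hμ : 0 < μ) (N K : ℕ) :
    IntegrableOn (fun s => Real.exp (-(lam * s)) * fewRingProb N K μ s) (Set.Ioi 0) := by
  simp_rw [fewRingProb, Finset.mul_sum]
  exact integrable_finsetSum _ fun i _ => integrableOn_exp_mul_ringProb hl hμ N i

end Gossip

namespace Gossip

/-! ### The expected waiting time and the probability of failure in one epoch -/

theorem measurable_card_filter {ι α : Type*} [Fintype ι] [MeasurableSpace α] {p : ι → α → Prop}
    [∀ a, DecidablePred fun e => p e a] (hp : ∀ e, MeasurableSet {a | p e a}) :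
    Measurable fun a => (Finset.univ.filter fun e => p e a).card := by
  simp_rw [Finset.card_filter]
  refine Finset.measurable_fun_sum _ fun e _ => ?_
  exact Measurable.ite (hp e) measurable_const measurable_const

variable {ι : Type*} [Fintype ι]

/-- The indicator of the event that less than `K` edges are activated in the epoch `y`. -/
noncomputable def failed (K : ℕ) (y : ℝ × (ι → ℝ)) : ℝ :=
  if (Finset.univ.filter fun e => y.2 e < y.1).card < K then 1 else 0

/-- The times in the epoch `y` when less than `K` edges have been activated. -/
def waitSet (K : ℕ) (y : ℝ × (ι → ℝ)) : Set ℝ :=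
  {s | (0 < s ∧ s < y.1) ∧ (Finset.univ.filter fun e => y.2 e ≤ s).card < K}

/-- The time in the epoch `y` when less than `K` edges have been activated. -/
noncomputable def waitTime (K : ℕ) (y : ℝ × (ι → ℝ)) : ℝ := (volume (waitSet K y)).toReal

theorem measurable_failed (K : ℕ) : Measurable (failed (ι := ι) K) := by
  have h := measurable_card_filter (p := fun e (y : ℝ × (ι → ℝ)) => y.2 e < y.1)
    fun e => measurableSet_lt (by fun_prop) (by fun_prop)
  exact Measurable.ite (h (measurableSet_Iio (a := K))) measurable_const measurable_const

theorem measurableSet_waitSet (K : ℕ) :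
    MeasurableSet {p : (ℝ × (ι → ℝ)) × ℝ | p.2 ∈ waitSet K p.1} := by
  have h := measurable_card_filter (p := fun e (p : (ℝ × (ι → ℝ)) × ℝ) => p.1.2 e ≤ p.2)
    fun e => measurableSet_le (by fun_prop) (by fun_prop)
  exact ((measurableSet_lt measurable_const measurable_snd).inter
    (measurableSet_lt measurable_snd (by fun_prop))).inter (h (measurableSet_Iio (a := K)))

theorem measurable_volume_waitSet (K : ℕ) :
    Measurable fun y : ℝ × (ι → ℝ) => volume (waitSet K y) :=
  measurable_measure_prodMk_left (measurableSet_waitSet K)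

theorem measurable_waitTime (K : ℕ) : Measurable (waitTime (ι := ι) K) :=
  (measurable_volume_waitSet K).ennreal_toReal

theorem volume_waitSet_le (K : ℕ) (y : ℝ × (ι → ℝ)) :
    volume (waitSet K y) ≤ ENNReal.ofReal y.1 := by
  calc volume (waitSet K y) ≤ volume (Set.Ioo 0 y.1) := measure_mono fun s hs => hs.1
    _ = _ := by rw [Real.volume_Ioo, sub_zero]

variable {lam μ : ℝ}

theorem lintegral_expMeasure {F : ℝ → ENNReal} (hF : Measurable F) :
    ∫⁻ s, F s ∂expMeasure lam
      = ∫⁻ s in Set.Ioi 0, ENNReal.ofReal (lam * Real.exp (-(lam * s))) * F s := by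
  have hm : Measurable (exponentialPDF lam) := (measurable_exponentialPDFReal lam).ennreal_ofReal
  have e : expMeasure lam = volume.withDensity (exponentialPDF lam) := rfl
  rw [e, lintegral_withDensity_eq_lintegral_mul _ hm hF, setLIntegral_congr Ioi_ae_eq_Ici,
    ← lintegral_indicator measurableSet_Ici]
  refine lintegral_congr fun s => ?_
  by_cases hs : 0 ≤ s
  · rw [Set.indicator_of_mem (Set.mem_Ici.2 hs), Pi.mul_apply, exponentialPDF_of_nonneg hs]
  · rw [Set.indicator_of_notMem (by simpa using hs), Pi.mul_apply,
      exponentialPDF_of_neg (not_le.1 hs), zero_mul]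

variable [Fact (0 < lam)] [Fact (0 < μ)]

theorem poissonLaw_head {B : Set ℝ} (hB : MeasurableSet B) :
    poissonLaw μ {h | h 0 ∈ B} = expMeasure μ B := by
  have h := Measure.infinitePi_map_eval (fun _ : ℕ => expMeasure μ) 0
  rw [← h, Measure.map_apply (measurable_pi_apply 0) hB]; rfl

/-- The event is split according to the exact set of edges whose first gap lies in `B`. Each such
piece is a box in the product space, and grouping the sets by cardinality yields the binomial sum.
-/
theorem pi_poissonLaw_card_lt {B : Set ℝ} [DecidablePred (· ∈ B)] (hB : MeasurableSet B) {p : ℝ}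
    (hp0 : 0 ≤ p) (hp1 : p ≤ 1) (hp : expMeasure μ B = ENNReal.ofReal p) (K : ℕ) :
    Measure.pi (fun _ : ι => poissonLaw μ)
        {h | (Finset.univ.filter fun e => h e 0 ∈ B).card < K}
      = ENNReal.ofReal (∑ i ∈ Finset.range K, ((Fintype.card ι).choose i : ℝ) * p ^ i
        * (1 - p) ^ (Fintype.card ι - i)) := by
  classical
  set N := Fintype.card ι
  have hq : expMeasure μ Bᶜ = ENNReal.ofReal (1 - p) := by
    rw [prob_compl_eq_one_sub hB, hp, ← ENNReal.ofReal_one, ENNReal.ofReal_sub _ hp0]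
  have hq0 : 0 ≤ 1 - p := by linarith
  let s : Finset (Finset ι) := (Finset.range K).biUnion fun i => Finset.univ.powersetCard i
  have hpi : ∀ A : Finset ι, {h : ι → ℕ → ℝ | (Finset.univ.filter fun e => h e 0 ∈ B) = A}
      = Set.pi Set.univ fun e => {g | g 0 ∈ if e ∈ A then B else Bᶜ} := by
    intro A; ext h
    simp only [Set.mem_ofPred_eq, Finset.ext_iff, Finset.mem_filter, Finset.mem_univ, true_and,
      Set.mem_pi, Set.mem_univ, true_implies]
    refine forall_congr' fun e => ?_
    split_ifs with he <;> simp [he]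
  have hm : ∀ e (A : Finset ι), MeasurableSet (if e ∈ A then B else Bᶜ) := fun e A => by
    split_ifs
    · exact hB
    · exact hB.compl
  have hset : {h : ι → ℕ → ℝ | (Finset.univ.filter fun e => h e 0 ∈ B).card < K}
      = ⋃ A ∈ s, {h : ι → ℕ → ℝ | (Finset.univ.filter fun e => h e 0 ∈ B) = A} := by
    ext h
    simp [s, Finset.mem_powersetCard]
  rw [hset, measure_biUnion_finset]
  · have hval : ∀ A ∈ s, Measure.pi (fun _ : ι => poissonLaw μ)
        {h : ι → ℕ → ℝ | (Finset.univ.filter fun e => h e 0 ∈ B) = A}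
        = ENNReal.ofReal (p ^ A.card * (1 - p) ^ (N - A.card)) := by
      intro A _
      rw [hpi, Measure.pi_pi]
      simp_rw [poissonLaw_head (hm _ A), apply_ite (expMeasure μ), hp, hq]
      rw [Finset.prod_ite, Finset.prod_const, Finset.prod_const, Finset.filter_mem_eq_inter,
        Finset.univ_inter, ← Finset.compl_filter, Finset.filter_mem_eq_inter, Finset.univ_inter,
        Finset.card_compl, ← ENNReal.ofReal_pow hp0, ← ENNReal.ofReal_pow hq0,
        ← ENNReal.ofReal_mul (by positivity)]
    rw [Finset.sum_congr rfl hval, ← ENNReal.ofReal_sum_of_nonneg fun A _ => by positivity]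
    congr 1
    rw [Finset.sum_biUnion fun i _ j _ hij => Finset.pairwise_disjoint_powersetCard _ hij]
    refine Finset.sum_congr rfl fun i _ => ?_
    rw [Finset.sum_congr rfl (g := fun _ => p ^ i * (1 - p) ^ (N - i)) fun A hA => by
      rw [(Finset.mem_powersetCard.1 hA).2], Finset.sum_const, Finset.card_powersetCard,
      Finset.card_univ, nsmul_eq_mul, mul_assoc]
  · intro A _ A' _ hne
    exact Set.disjoint_left.2 fun h h1 h2 => hne (h1.symm.trans h2)
  · intro A _
    rw [hpi]
    exact MeasurableSet.univ_pi fun e => (measurable_pi_apply 0) (hm e A)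

theorem pi_poissonLaw_card_le_lt {s : ℝ} (hs : 0 ≤ s) (K : ℕ) :
    Measure.pi (fun _ : ι => poissonLaw μ)
        {h | (Finset.univ.filter fun e => h e 0 ≤ s).card < K}
      = ENNReal.ofReal (fewRingProb (Fintype.card ι) K μ s) := by
  obtain ⟨h0, h1⟩ := exp_neg_mul_mem_Icc (μ := μ) Fact.out hs
  have hp : expMeasure μ (Set.Iic s) = ENNReal.ofReal (1 - Real.exp (-(μ * s))) := by
    rw [← ofReal_cdf, cdf_expMeasure_eq Fact.out, if_pos hs]
  refine (pi_poissonLaw_card_lt measurableSet_Iic (sub_nonneg.2 h1) (by linarith) hp K).trans ?_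
  simp only [sub_sub_cancel]; rfl

theorem pi_poissonLaw_card_lt_lt {s : ℝ} (hs : 0 ≤ s) (K : ℕ) :
    Measure.pi (fun _ : ι => poissonLaw μ)
        {h | (Finset.univ.filter fun e => h e 0 < s).card < K}
      = ENNReal.ofReal (fewRingProb (Fintype.card ι) K μ s) := by
  obtain ⟨h0, h1⟩ := exp_neg_mul_mem_Icc (μ := μ) Fact.out hs
  have hp : expMeasure μ (Set.Iio s) = ENNReal.ofReal (1 - Real.exp (-(μ * s))) := by
    rw [measure_congr Iio_ae_eq_Iic, ← ofReal_cdf, cdf_expMeasure_eq Fact.out, if_pos hs]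
  refine (pi_poissonLaw_card_lt measurableSet_Iio (sub_nonneg.2 h1) (by linarith) hp K).trans ?_
  simp only [sub_sub_cancel]; rfl

theorem gapLaw_apply_source {A : Set (ℝ × (ι → ℕ → ℝ))} (hA : MeasurableSet A) :
    gapLaw ι lam μ ((fun x => (x.1 0, x.2)) ⁻¹' A)
      = ∫⁻ s, Measure.pi (fun _ : ι => poissonLaw μ) (Prod.mk s ⁻¹' A) ∂expMeasure lam := by
  have hm : Measurable fun x : GapSpace ι => (x.1 0, x.2) := by fun_prop
  rw [gapLaw, Measure.prod_apply (hm hA), ← Measure.infinitePi_map_eval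
    (fun _ : ℕ => expMeasure lam) 0, lintegral_map (measurable_measure_prodMk_left hA)
    (measurable_pi_apply 0)]
  rfl

/-- Conditioning on the epoch length s, of density lam · exp(-lam s), turns failure into a binomial
event at time s. -/
theorem gapLaw_failed (K : ℕ) :
    gapLaw ι lam μ {x | (Finset.univ.filter fun e => (firstEpoch x).2 e < (firstEpoch x).1).card < K}
      = ENNReal.ofReal (lam * ∫ s in Set.Ioi 0, Real.exp (-(lam * s))
        * fewRingProb (Fintype.card ι) K μ s) := by
  have hl : 0 < lam := Fact.out
  have hμ : 0 < μ := Fact.out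
  have hA : MeasurableSet {p : ℝ × (ι → ℕ → ℝ) |
      (Finset.univ.filter fun e => p.2 e 0 < p.1).card < K} :=
    measurable_card_filter (p := fun e (p : ℝ × (ι → ℕ → ℝ)) => p.2 e 0 < p.1)
      (fun e => measurableSet_lt (by fun_prop) (by fun_prop)) (measurableSet_Iio (a := K))
  have hint := (integrableOn_exp_mul_fewRingProb hl hμ (Fintype.card ι) K).const_mul lam
  have e : {x : GapSpace ι | (Finset.univ.filter fun e =>
      (firstEpoch x).2 e < (firstEpoch x).1).card < K}
      = (fun x => (x.1 0, x.2)) ⁻¹' {p : ℝ × (ι → ℕ → ℝ) |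
      (Finset.univ.filter fun e => p.2 e 0 < p.1).card < K} := by
    ext x; simp [firstEpoch]
  rw [e, gapLaw_apply_source hA, lintegral_expMeasure (measurable_measure_prodMk_left hA),
    ← integral_const_mul, ofReal_integral_eq_lintegral_ofReal hint]
  · refine setLIntegral_congr_fun measurableSet_Ioi fun s hs => ?_
    have hs' : (0 : ℝ) ≤ s := le_of_lt hs
    have := pi_poissonLaw_card_lt_lt (ι := ι) (μ := μ) hs' K
    rw [Set.preimage_ofPred_eq, this, ← ENNReal.ofReal_mul (by positivity), mul_assoc]
  · refine (ae_restrict_iff' measurableSet_Ioi).2 (Eventually.of_forall fun s hs => ?_)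
    exact mul_nonneg hl.le (mul_nonneg (Real.exp_pos _).le
      (fewRingProb_nonneg hμ _ K (le_of_lt hs)))

theorem integral_failed {K : ℕ} (hK : K ≤ Fintype.card ι) :
    ∫ x, failed K (firstEpoch x) ∂gapLaw ι lam μ = 1 - winProb lam μ (Fintype.card ι) K := by
  have hl : 0 < lam := Fact.out
  have hμ : 0 < μ := Fact.out
  have h := measurable_card_filter (p := fun e (y : ℝ × (ι → ℝ)) => y.2 e < y.1)
    fun e => measurableSet_lt (by fun_prop) (by fun_prop)
  have hm : MeasurableSet {x : GapSpace ι | (Finset.univ.filter fun e =>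
      (firstEpoch x).2 e < (firstEpoch x).1).card < K} :=
    (h.comp measurable_firstEpoch) (measurableSet_Iio (a := K))
  have e : (fun x : GapSpace ι => failed K (firstEpoch x))
      = Set.indicator {x : GapSpace ι | (Finset.univ.filter fun e =>
      (firstEpoch x).2 e < (firstEpoch x).1).card < K} (fun _ => 1) := by
    funext x; simp [failed, Set.indicator]
  rw [e, integral_indicator hm, setIntegral_const, smul_eq_mul, mul_one, Measure.real,
    gapLaw_failed, ENNReal.toReal_ofReal, integral_fewRingProb hl hμ _ K hK]
  exact mul_nonneg hl.le (setIntegral_nonneg measurableSet_Ioi fun s hs =>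
    mul_nonneg (Real.exp_pos _).le (fewRingProb_nonneg hμ _ K (le_of_lt hs)))

/-- By Fubini the expected waiting time is the integral over s of the probability that the epoch
outlasts s, namely exp(-lam s), and that fewer than `K` edges have rung by s. This is the failure
probability divided by `lam`. -/
theorem lintegral_volume_waitSet (K : ℕ) :
    ∫⁻ x, volume (waitSet K (firstEpoch x)) ∂gapLaw ι lam μ
      = ENNReal.ofReal (∫ s in Set.Ioi 0, Real.exp (-(lam * s))
        * fewRingProb (Fintype.card ι) K μ s) := by
  have hl : 0 < lam := Fact.out
  have hμ : 0 < μ := Fact.out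
  have hint := integrableOn_exp_mul_fewRingProb hl hμ (Fintype.card ι) K
  have hA : MeasurableSet {p : GapSpace ι × ℝ | p.2 ∈ waitSet K (firstEpoch p.1)} :=
    ((measurable_firstEpoch.comp measurable_fst).prodMk measurable_snd) (measurableSet_waitSet K)
  have e1 : ∫⁻ x, volume (waitSet K (firstEpoch x)) ∂gapLaw ι lam μ
      = ((gapLaw ι lam μ).prod volume) {p | p.2 ∈ waitSet K (firstEpoch p.1)} :=
    (Measure.prod_apply hA).symm
  rw [e1, Measure.prod_apply_symm hA, ofReal_integral_eq_lintegral_ofReal hint,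
    ← lintegral_indicator measurableSet_Ioi]
  · refine lintegral_congr fun s => ?_
    by_cases hs : 0 < s
    · rw [Set.indicator_of_mem (Set.mem_Ioi.2 hs)]
      have e : (fun x => (x, s)) ⁻¹' {p : GapSpace ι × ℝ | p.2 ∈ waitSet K (firstEpoch p.1)}
          = {g : ℕ → ℝ | g 0 ∈ Set.Ioi s} ×ˢ {h : ι → ℕ → ℝ |
            (Finset.univ.filter fun e => h e 0 ≤ s).card < K} := by
        ext x
        simp only [Set.mem_preimage, waitSet, Set.mem_ofPred_eq, firstEpoch, hs, true_and,
          Set.mem_prod, Set.mem_Ioi, min_le_iff]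
        refine and_congr_right fun hlt => ?_
        simp only [not_le.2 hlt, or_false]
      rw [e, gapLaw, Measure.prod_prod, poissonLaw_head measurableSet_Ioi, expMeasure_Ioi hs.le,
        pi_poissonLaw_card_le_lt hs.le, ENNReal.ofReal_mul (Real.exp_pos _).le]
    · rw [Set.indicator_of_notMem (by simpa using hs)]
      have e : (fun x => (x, s)) ⁻¹' {p : GapSpace ι × ℝ | p.2 ∈ waitSet K (firstEpoch p.1)}
          = ∅ := by
        ext x; simp [waitSet, hs]
      rw [e, measure_empty]
  · refine (ae_restrict_iff' measurableSet_Ioi).2 (Eventually.of_forall fun s hs => ?_)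
    exact mul_nonneg (Real.exp_pos _).le (fewRingProb_nonneg hμ _ K (le_of_lt hs))

theorem integral_waitTime {K : ℕ} (hK : K ≤ Fintype.card ι) :
    ∫ x, waitTime K (firstEpoch x) ∂gapLaw ι lam μ
      = (1 - winProb lam μ (Fintype.card ι) K) / lam := by
  have hl : 0 < lam := Fact.out
  have hμ : 0 < μ := Fact.out
  have hm : Measurable fun x : GapSpace ι => volume (waitSet K (firstEpoch x)) :=
    (measurable_volume_waitSet K).comp measurable_firstEpoch
  have h := integral_toReal (μ := gapLaw ι lam μ) hm.aemeasurable (Eventually.of_forall fun x =>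
    (volume_waitSet_le K (firstEpoch x)).trans_lt ENNReal.ofReal_lt_top)
  have : ∫ x, waitTime K (firstEpoch x) ∂gapLaw ι lam μ
      = ∫ x, (volume (waitSet K (firstEpoch x))).toReal ∂gapLaw ι lam μ := rfl
  rw [this, h, lintegral_volume_waitSet, ENNReal.toReal_ofReal,
    eq_div_iff hl.ne', mul_comm, integral_fewRingProb hl hμ _ K hK]
  exact setIntegral_nonneg measurableSet_Ioi fun s hs =>
    mul_nonneg (Real.exp_pos _).le (fewRingProb_nonneg hμ _ K (le_of_lt hs))

theorem measurePreserving_source_zero :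
    MeasurePreserving (fun x : GapSpace ι => x.1 0) (gapLaw ι lam μ) (expMeasure lam) :=
  (measurePreserving_eval_infinitePi (fun _ : ℕ => expMeasure lam) 0).comp
    (measurePreserving_fst (μ := poissonLaw lam) (ν := Measure.pi fun _ : ι => poissonLaw μ))

/-- Supplies the second moments for the strong law, both for the epoch lengths and for the waiting
times they dominate. -/
theorem memLp_id_expMeasure : MemLp (fun s => s) 2 (expMeasure lam) := by
  have hl : 0 < lam := Fact.out
  have h := integrableOn_rpow_mul_exp_neg_mul_rpow (p := 1) (s := 2) (b := lam) (by norm_num)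
    one_pos hl
  have h2 := h.const_mul lam
  rw [memLp_two_iff_integrable_sq (by fun_prop)]
  refine ⟨by fun_prop, ?_⟩
  rw [hasFiniteIntegral_iff_ofReal (Eventually.of_forall fun s => sq_nonneg s),
    lintegral_expMeasure (by fun_prop)]
  have h3 := h2.2
  rw [hasFiniteIntegral_iff_ofReal] at h3
  · refine lt_of_eq_of_lt (setLIntegral_congr_fun measurableSet_Ioi fun s _ => ?_) h3
    rw [← ENNReal.ofReal_mul (by positivity)]
    congr 1
    simp only [Real.rpow_one, Real.rpow_ofNat]
    rw [neg_mul]; ring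
  · refine (ae_restrict_iff' measurableSet_Ioi).2 (Eventually.of_forall fun s hs => ?_)
    have : (0 : ℝ) < s := hs
    simp only [Pi.zero_apply]; positivity

theorem integral_id_expMeasure : ∫ s, s ∂expMeasure lam = 1 / lam := by
  have hl : 0 < lam := Fact.out
  rw [Integrable.integral_eq_integral_meas_lt (memLp_id_expMeasure.integrable one_le_two)
    (ae_pos_expMeasure.mono fun s hs => hs.le)]
  have e : ∫ t in Set.Ioi 0, (expMeasure lam).real {a | t < a}
      = ∫ t in Set.Ioi 0, Real.exp (-lam * t) := by
    refine setIntegral_congr_fun measurableSet_Ioi fun t ht => ?_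
    have : {a | t < a} = Set.Ioi t := rfl
    simp only [Measure.real, this]
    rw [expMeasure_Ioi (le_of_lt ht), ENNReal.toReal_ofReal (Real.exp_pos _).le, neg_mul]
  rw [e, integral_exp_mul_Ioi (by linarith)]
  simp

theorem memLp_firstEpoch_fst : MemLp (fun x : GapSpace ι => (firstEpoch x).1) 2 (gapLaw ι lam μ) :=
  memLp_id_expMeasure.comp_measurePreserving measurePreserving_source_zero

theorem integral_firstEpoch_fst : ∫ x : GapSpace ι, (firstEpoch x).1 ∂gapLaw ι lam μ = 1 / lam := by
  rw [← integral_id_expMeasure (lam := lam),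
    ← (measurePreserving_source_zero (ι := ι) (lam := lam) (μ := μ)).map_eq,
    integral_map (by fun_prop) (by fun_prop)]
  rfl

theorem memLp_waitTime (K : ℕ) :
    MemLp (fun x : GapSpace ι => waitTime K (firstEpoch x)) 2 (gapLaw ι lam μ) := by
  refine memLp_firstEpoch_fst.of_le
    ((measurable_waitTime K).comp measurable_firstEpoch).aestronglyMeasurable ?_
  have h := measurePreserving_source_zero (ι := ι) (lam := lam) (μ := μ)
  filter_upwards [h.quasiMeasurePreserving.ae ae_pos_expMeasure] with x hx
  have hx' : 0 ≤ (firstEpoch x).1 := le_of_lt hx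
  rw [waitTime, Real.norm_of_nonneg ENNReal.toReal_nonneg, Real.norm_of_nonneg hx']
  exact ENNReal.toReal_le_of_le_ofReal hx' (volume_waitSet_le K _)

end Gossip

namespace Gossip

/-! ### The epochs of one realization -/

theorem monotone_arrival {h : ℕ → ℝ} (h0 : ∀ n, 0 ≤ h n) : Monotone (arrival h) :=
  monotone_nat_of_le_succ fun n => by rw [arrival_succ]; linarith [h0 (n + 1)]

/-- The gaps are nonnegative and the arrival times are unbounded. -/
structure IsLocallyFinite (h : ℕ → ℝ) : Prop where
  nonneg : ∀ n, 0 ≤ h n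
  unbounded : ∀ u : ℝ, ∃ n, u ≤ arrival h n

theorem arrival_residual (u : ℝ) (h : ℕ → ℝ) (r : ℕ) :
    arrival (residual u h) r = arrival h (nextIndex u h + r) - u := by
  induction r with
  | zero => simp [arrival_zero, residual, residualAt]
  | succ r ih =>
    rw [arrival_succ, ih, ← add_assoc, arrival_succ]
    simp only [residual, residualAt, cons_succ]
    rw [show nextIndex u h + 1 + r = nextIndex u h + r + 1 by ring]; ring

namespace IsLocallyFinite

variable {h : ℕ → ℝ}

theorem residual (hh : IsLocallyFinite h) (u : ℝ) : IsLocallyFinite (residual u h) := by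
  have hN := isNext_nextIndex (hh.unbounded u)
  refine ⟨fun n => ?_, fun v => ?_⟩
  · cases n with
    | zero => exact sub_nonneg.2 hN.1
    | succ n => exact hh.nonneg _
  · obtain ⟨n, hn⟩ := hh.unbounded (v + u)
    refine ⟨n, ?_⟩
    rw [arrival_residual]
    have := monotone_arrival hh.nonneg (Nat.le_add_left n (nextIndex u h))
    linarith

theorem exists_arrival_residual_iff (hh : IsLocallyFinite h) {u t : ℝ} :
    (∃ r, arrival (Gossip.residual u h) r + u = t) ↔ (∃ r, arrival h r = t) ∧ u ≤ t := by
  have hN := isNext_nextIndex (hh.unbounded u)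
  simp only [arrival_residual, sub_add_cancel]
  constructor
  · rintro ⟨r, rfl⟩
    exact ⟨⟨_, rfl⟩, hN.1.trans (monotone_arrival hh.nonneg (Nat.le_add_right _ _))⟩
  · rintro ⟨⟨r, rfl⟩, hu⟩
    have : nextIndex u h ≤ r := not_lt.1 fun hlt => absurd (hN.2 r hlt) (not_lt.2 hu)
    exact ⟨r - nextIndex u h, by rw [Nat.add_sub_cancel' this]⟩

end IsLocallyFinite

variable {ι : Type*}

/-- The time when version `l` is generated. -/
def epochStart (z : GapSpace ι) (l : ℕ) : ℝ := ∑ q ∈ Finset.range l, z.1 q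

/-- The first epoch after `l` shifts. -/
noncomputable def epoch (z : GapSpace ι) (l : ℕ) : ℝ × (ι → ℝ) := firstEpoch (shift^[l] z)

/-- The properties of the gaps which hold almost surely. -/
structure IsRegular (z : GapSpace ι) : Prop where
  source_pos : ∀ n, 0 < z.1 n
  source_unbounded : ∀ u : ℝ, ∃ n, u ≤ arrival z.1 n
  edge : ∀ e, IsLocallyFinite (z.2 e)

theorem shift_iterate_fst (z : GapSpace ι) (l r : ℕ) : (shift^[l] z).1 r = z.1 (l + r) := by
  induction l generalizing r with
  | zero => simp
  | succ l ih =>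
    rw [Function.iterate_succ_apply']
    simp only [shift, tail, ih]
    exact congrArg z.1 (by ring)

theorem epoch_fst (z : GapSpace ι) (l : ℕ) : (epoch z l).1 = z.1 l := shift_iterate_fst z l 0

theorem epochStart_succ (z : GapSpace ι) (l : ℕ) :
    epochStart z (l + 1) = epochStart z l + z.1 l := Finset.sum_range_succ _ _

theorem epochStart_zero (z : GapSpace ι) : epochStart z 0 = 0 := rfl

theorem arrival_eq_epochStart (z : GapSpace ι) (l : ℕ) : arrival z.1 l = epochStart z (l + 1) := rfl

namespace IsRegular

variable {z : GapSpace ι} (hz : IsRegular z)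
include hz

theorem strictMono_epochStart : StrictMono (epochStart z) :=
  strictMono_nat_of_lt_succ fun l => by rw [epochStart_succ]; linarith [hz.source_pos l]

theorem epochStart_nonneg (l : ℕ) : 0 ≤ epochStart z l :=
  hz.strictMono_epochStart.monotone (Nat.zero_le l)

theorem exists_epoch {t : ℝ} (ht : 0 ≤ t) :
    ∃ l, epochStart z l ≤ t ∧ t < epochStart z (l + 1) := by
  classical
  have hex : ∃ n, t < epochStart z (n + 1) := by
    obtain ⟨n, hn⟩ := hz.source_unbounded (t + 1)
    exact ⟨n, by rw [arrival_eq_epochStart] at hn; linarith⟩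
  refine ⟨Nat.find hex, ?_, Nat.find_spec hex⟩
  rcases hl : Nat.find hex with _ | l
  · exact ht
  · exact not_lt.1 (Nat.find_min hex (hl ▸ Nat.lt_succ_self l))

theorem edge_iterate (l : ℕ) (e : ι) : IsLocallyFinite ((shift^[l] z).2 e) := by
  induction l with
  | zero => exact hz.edge e
  | succ l ih =>
    rw [Function.iterate_succ_apply']
    exact ih.residual _

/-- Repeated shifting loses no activation after the start of epoch `l`, creates none, and keeps the
absolute times. This ties the epochs of the shift dynamics to the actual time axis. -/
theorem exists_arrival_iterate_iff (l : ℕ) (e : ι) {t : ℝ} :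
    (∃ r, arrival ((shift^[l] z).2 e) r + epochStart z l = t)
      ↔ (∃ r, arrival (z.2 e) r = t) ∧ epochStart z l ≤ t := by
  induction l generalizing t with
  | zero =>
    simp only [Function.iterate_zero, id, epochStart_zero, add_zero, iff_self_and]
    rintro ⟨r, rfl⟩
    exact Finset.sum_nonneg fun q _ => (hz.edge e).nonneg q
  | succ l ih =>
    have hs := epochStart_succ z l
    have hp := hz.source_pos l
    have h1 := (hz.edge_iterate l e).exists_arrival_residual_iff (u := z.1 l)
      (t := t - epochStart z l)
    have e1 : (shift^[l + 1] z).2 e = residual (z.1 l) ((shift^[l] z).2 e) := by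
      rw [Function.iterate_succ_apply']
      simp only [shift, shift_iterate_fst, add_zero]
    have h2 := ih (t := t)
    rw [e1]
    have a1 : (∃ r, arrival (residual (z.1 l) ((shift^[l] z).2 e)) r + epochStart z (l + 1) = t)
        ↔ ∃ r, arrival (residual (z.1 l) ((shift^[l] z).2 e)) r + z.1 l = t - epochStart z l := by
      refine exists_congr fun r => ?_
      rw [hs]; constructor <;> intro h <;> linarith
    have a2 : (∃ r, arrival ((shift^[l] z).2 e) r = t - epochStart z l)
        ↔ ∃ r, arrival ((shift^[l] z).2 e) r + epochStart z l = t := by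
      refine exists_congr fun r => ?_
      constructor <;> intro h <;> linarith
    rw [a1, h1, a2, h2, and_assoc]
    refine and_congr_right fun _ => ⟨fun h => by linarith [h.2], fun h => ⟨by linarith, by linarith⟩⟩

/-- The arrivals of an edge in an initial segment of an epoch. -/
theorem exists_arrival_iff (l : ℕ) (e : ι) (p : ℝ → Prop) (hp : ∀ s t, s ≤ t → p t → p s) :
    (∃ r, epochStart z l ≤ arrival (z.2 e) r ∧ p (arrival (z.2 e) r - epochStart z l))
      ↔ p ((shift^[l] z).2 e 0) := by
  have hl := hz.edge_iterate l e
  constructor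
  · rintro ⟨r, h1, h2⟩
    obtain ⟨q, hq⟩ := (hz.exists_arrival_iterate_iff l e).2 ⟨⟨r, rfl⟩, h1⟩
    rw [← hq, add_sub_cancel_right] at h2
    refine hp _ _ ?_ h2
    rw [← arrival_zero ((shift^[l] z).2 e)]
    exact monotone_arrival hl.nonneg (Nat.zero_le q)
  · intro h
    obtain ⟨⟨r, hr⟩, h2⟩ := (hz.exists_arrival_iterate_iff l e).1 ⟨0, rfl⟩
    refine ⟨r, by rw [hr]; exact h2, ?_⟩
    rw [hr, add_sub_cancel_right, arrival_zero]
    exact h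

theorem exists_arrival_lt_iff (l : ℕ) (e : ι) :
    (∃ r, epochStart z l ≤ arrival (z.2 e) r ∧ arrival (z.2 e) r < epochStart z (l + 1))
      ↔ (epoch z l).2 e < (epoch z l).1 := by
  have h := hz.exists_arrival_iff l e (fun s => s < z.1 l) fun s t hst ht => hst.trans_lt ht
  have e1 : (epoch z l).2 e < (epoch z l).1 ↔ (shift^[l] z).2 e 0 < z.1 l := by
    rw [epoch_fst]
    simp only [epoch, firstEpoch, shift_iterate_fst, add_zero, min_lt_iff, lt_self_iff_false,
      or_false]
  rw [e1, ← h]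
  refine exists_congr fun r => and_congr_right fun _ => ?_
  rw [epochStart_succ]
  constructor <;> intro h <;> linarith

theorem exists_arrival_le_iff {l : ℕ} (e : ι) {t : ℝ} (ht : t < epochStart z (l + 1)) :
    (∃ r, epochStart z l ≤ arrival (z.2 e) r ∧ arrival (z.2 e) r ≤ t)
      ↔ (epoch z l).2 e ≤ t - epochStart z l := by
  have h := hz.exists_arrival_iff l e (fun s => s ≤ t - epochStart z l)
    fun s t hst ht => hst.trans ht
  rw [epochStart_succ] at ht
  have e1 : (epoch z l).2 e ≤ t - epochStart z l ↔ (shift^[l] z).2 e 0 ≤ t - epochStart z l := by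
    simp only [epoch, firstEpoch, shift_iterate_fst, add_zero, min_le_iff]
    refine or_iff_left ?_
    rw [not_le]; linarith
  rw [e1, ← h]
  refine exists_congr fun r => and_congr_right fun _ => ?_
  constructor <;> intro h <;> linarith

end IsRegular

/-! ### The version age of one realization -/

variable {m : ℕ}

/-- The subscribers other than `j`. -/
abbrev Provider (S : Finset (Fin m)) (j : Fin m) : Type := {i : Fin m // i ∈ S ∧ i ≠ j}

/-- The arrival times `x` of the source and of the edges from `S` to `j` have the gaps `z`. -/
structure HasGaps (x : Counter m → ℕ → ℝ) (S : Finset (Fin m)) (j : Fin m)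
    (z : GapSpace (Provider S j)) : Prop where
  source : ∀ r, x none r = arrival z.1 r
  edge : ∀ (e : Provider S j) (r : ℕ), x (some ⟨(e.1, j), e.2.2⟩) r = arrival (z.2 e) r

/-- The number of keys which node `j` has to receive from others. -/
def neededKeys (k : ℕ) (S : Finset (Fin m)) (j : Fin m) : ℕ := if j ∈ S then k else k + 1

section Path

variable {x : Counter m → ℕ → ℝ} {S : Finset (Fin m)} {j : Fin m} {z : GapSpace (Provider S j)}
  (hx : HasGaps x S j z) (hz : IsRegular z)
include hx hz

theorem sourceVersion_eq {l : ℕ} {t : ℝ} (h1 : epochStart z l ≤ t) (h2 : t < epochStart z (l + 1)) :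
    sourceVersion x t = l := by
  have : {r : ℕ | x none r ≤ t} = (Finset.range l : Set ℕ) := by
    ext r
    simp only [Set.mem_ofPred_eq, hx.source, arrival_eq_epochStart, Finset.coe_range, Set.mem_Iio]
    constructor
    · intro h
      have := hz.strictMono_epochStart.lt_iff_lt.1 (h.trans_lt h2)
      omega
    · intro h
      exact (hz.strictMono_epochStart.monotone (show r + 1 ≤ l by omega)).trans h1
  rw [sourceVersion, this, Set.ncard_coe_finset, Finset.card_range]

theorem sourceVersion_eq_iff {l : ℕ} {t : ℝ} (ht : 0 ≤ t) :
    sourceVersion x t = l ↔ epochStart z l ≤ t ∧ t < epochStart z (l + 1) := by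
  refine ⟨fun h => ?_, fun h => sourceVersion_eq hx hz h.1 h.2⟩
  obtain ⟨l', h1, h2⟩ := hz.exists_epoch ht
  have := sourceVersion_eq hx hz h1 h2
  rw [h] at this
  subst this
  exact ⟨h1, h2⟩

theorem holdsKey_provider_iff {l : ℕ} {e : Provider S j} {t : ℝ} :
    HoldsKey x S l e j t ↔ ∃ r, (epochStart z l ≤ arrival (z.2 e) r ∧
      arrival (z.2 e) r < epochStart z (l + 1)) ∧ arrival (z.2 e) r ≤ t := by
  have hne : e.1 ≠ j := e.2.2
  have hr : ∀ r, 0 ≤ arrival (z.2 e) r := fun r =>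
    Finset.sum_nonneg fun q _ => (hz.edge e).nonneg q
  constructor
  · rintro ⟨-, h | ⟨h, r, h1, h2⟩⟩
    · exact absurd h.1 hne
    · rw [hx.edge] at h1 h2
      exact ⟨r, (sourceVersion_eq_iff hx hz (hr r)).1 h2, h1⟩
  · rintro ⟨r, h2, h1⟩
    refine ⟨e.2.1, Or.inr ⟨hne, r, ?_, ?_⟩⟩
    · rw [hx.edge]; exact h1
    · rw [hx.edge]; exact (sourceVersion_eq_iff hx hz (hr r)).2 h2

omit hx hz in
-- The keys held by `j` are those of the providers that reached it together with its own if it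
-- subscribes. The own key is present only once the version exists, hence the bound on `l`.
theorem canDecrypt_iff {k l : ℕ} {t : ℝ} (hl : l ≤ sourceVersion x t)
    {p : Provider S j → Prop} [DecidablePred p] (hp : ∀ e : Provider S j, HoldsKey x S l e j t ↔ p e) :
    CanDecrypt x k S l j t ↔ neededKeys k S j ≤ (Finset.univ.filter p).card := by
  classical
  have hset : {i : Fin m | HoldsKey x S l i j t}
      = (((Finset.univ.filter p).map (Function.Embedding.subtype _)
        ∪ if j ∈ S then {j} else ∅ : Finset (Fin m)) : Set (Fin m)) := by
    ext i
    simp only [Set.mem_ofPred_eq, Finset.coe_union, Finset.coe_map, Set.mem_union, Set.mem_image,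
      Finset.mem_coe, Finset.mem_filter, Finset.mem_univ, true_and]
    by_cases hij : i = j
    · subst hij
      have h1 : HoldsKey x S l i i t ↔ i ∈ S :=
        ⟨fun h => h.1, fun h => ⟨h, Or.inl ⟨rfl, hl⟩⟩⟩
      rw [h1]
      constructor
      · intro h; right; simp [h]
      · rintro (⟨e, -, he⟩ | h)
        · exact absurd he e.2.2
        · by_contra hS; simp [hS] at h
    · constructor
      · intro h
        exact Or.inl ⟨⟨i, h.1, hij⟩, (hp ⟨i, h.1, hij⟩).1 h, rfl⟩
      · rintro (⟨e, he, rfl⟩ | h)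
        · exact (hp e).2 he
        · split_ifs at h <;> simp [hij] at h
  have hdisj : Disjoint ((Finset.univ.filter p).map (Function.Embedding.subtype _))
      (if j ∈ S then {j} else ∅ : Finset (Fin m)) := by
    rw [Finset.disjoint_left]
    intro i hi h
    obtain ⟨e, -, rfl⟩ := Finset.mem_map.1 hi
    split_ifs at h
    · exact e.2.2 (Finset.mem_singleton.1 h)
    · simp at h
  rw [CanDecrypt, hset, Set.ncard_coe_finset, Finset.card_union_of_disjoint hdisj, Finset.card_map,
    neededKeys]
  split_ifs <;> simp

/-- For a past version the key count was frozen when its epoch ended, since later activations carry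
newer versions only. -/
theorem canDecrypt_of_lt_iff {k l L : ℕ} {t : ℝ} (h1 : epochStart z L ≤ t)
    (h2 : t < epochStart z (L + 1)) (hl : l < L) :
    CanDecrypt x k S l j t ↔ failed (neededKeys k S j) (epoch z l) = 0 := by
  rw [canDecrypt_iff (p := fun e => (epoch z l).2 e < (epoch z l).1)
    (hl.le.trans_eq (sourceVersion_eq hx hz h1 h2).symm)]
  · simp [failed]
  · intro e
    rw [holdsKey_provider_iff hx hz, ← hz.exists_arrival_lt_iff]
    refine exists_congr fun r => and_iff_left_of_imp fun h => ?_
    exact h.2.le.trans ((hz.strictMono_epochStart.monotone hl).trans h1)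

theorem canDecrypt_current_iff {k L : ℕ} {t : ℝ} (h1 : epochStart z L ≤ t)
    (h2 : t < epochStart z (L + 1)) : CanDecrypt x k S L j t ↔ neededKeys k S j
      ≤ (Finset.univ.filter fun e => (epoch z L).2 e ≤ t - epochStart z L).card := by
  rw [canDecrypt_iff (p := fun e => (epoch z L).2 e ≤ t - epochStart z L)
    (sourceVersion_eq hx hz h1 h2).ge]
  intro e
  rw [holdsKey_provider_iff hx hz, ← hz.exists_arrival_le_iff e h2]
  refine exists_congr fun r => ⟨fun h => ⟨h.1.1, h.2⟩, fun h => ⟨⟨h.1, h.2.trans_lt h2⟩, h.2⟩⟩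

theorem not_canDecrypt_of_lt {k l L : ℕ} {t : ℝ} (h1 : epochStart z L ≤ t)
    (h2 : t < epochStart z (L + 1)) (hl : L < l) : ¬ CanDecrypt x k S l j t := by
  have hset : {i : Fin m | HoldsKey x S l i j t} = ∅ := by
    refine Set.eq_empty_iff_forall_notMem.2 fun i hi => ?_
    by_cases hij : i = j
    · subst hij
      rcases hi.2 with h | ⟨h, -⟩
      · rw [sourceVersion_eq hx hz h1 h2] at h; omega
      · exact h rfl
    · obtain ⟨r, h, hr⟩ := (holdsKey_provider_iff hx hz (e := ⟨i, hi.1, hij⟩)).1 hi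
      have := hz.strictMono_epochStart.lt_iff_lt.1 ((h.1.trans hr).trans_lt h2)
      omega
  rw [CanDecrypt, hset, Set.ncard_empty]
  omega

omit hx hz in
/-- The distance from the current version to the latest version decrypted in its own epoch. -/
theorem runAge_eq (K L : ℕ) :
    runAge (failed K) firstEpoch shift L z
      = (L : ℝ) - (sSup {l : ℕ | l < L ∧ failed K (epoch z l) = 0} : ℕ) := by
  induction L with
  | zero => simp [runAge]
  | succ L ih =>
    rw [runAge, ih]
    change 1 + _ * failed K (epoch z L) = _
    by_cases hf : failed K (epoch z L) = 0
    · have : sSup {l : ℕ | l < L + 1 ∧ failed K (epoch z l) = 0} = L := by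
        refine le_antisymm (csSup_le ⟨L, by simp [hf]⟩ fun l hl => by
          have := hl.1; omega) (le_csSup ⟨L, fun l hl => by have := hl.1; omega⟩ ?_)
        exact ⟨by omega, hf⟩
      rw [this, hf]; push_cast; ring
    · have h1 : failed K (epoch z L) = 1 := by
        unfold failed at hf ⊢
        split_ifs at hf ⊢ with h
        · rfl
        · exact absurd rfl hf
      have : {l : ℕ | l < L + 1 ∧ failed K (epoch z l) = 0}
          = {l : ℕ | l < L ∧ failed K (epoch z l) = 0} := by
        ext l
        simp only [Set.mem_ofPred_eq]
        refine ⟨fun h => ⟨?_, h.2⟩, fun h => ⟨by omega, h.2⟩⟩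
        rcases Nat.lt_succ_iff_lt_or_eq.1 h.1 with h' | rfl
        · exact h'
        · exact absurd h.2 hf
      rw [this, h1]; push_cast; ring

/-- Either the current version is already decryptable, or the latest decryptable one is the last
successful past epoch. If there is none, `sSup ∅ = 0` on both sides agrees with version 0 as the
default. -/
theorem versionAge_eq {k L : ℕ} {t : ℝ} (h1 : epochStart z L ≤ t) (h2 : t < epochStart z (L + 1)) :
    versionAge x k S j t = if neededKeys k S j
      ≤ (Finset.univ.filter fun e => (epoch z L).2 e ≤ t - epochStart z L).card then 0
      else runAge (failed (neededKeys k S j)) firstEpoch shift L z := by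
  rw [versionAge, sourceVersion_eq hx hz h1 h2]
  have hbdd : ∀ l ∈ {l : ℕ | CanDecrypt x k S l j t}, l ≤ L := fun l hl =>
    not_lt.1 fun hlt => not_canDecrypt_of_lt hx hz h1 h2 hlt hl
  split_ifs with hc
  · have hL := (canDecrypt_current_iff hx hz (k := k) h1 h2).2 hc
    have : decryptedVersion x k S j t = L :=
      le_antisymm (csSup_le ⟨L, hL⟩ hbdd) (le_csSup ⟨L, hbdd⟩ hL)
    rw [this, sub_self]
  · rw [runAge_eq]
    have : {l : ℕ | CanDecrypt x k S l j t}
        = {l : ℕ | l < L ∧ failed (neededKeys k S j) (epoch z l) = 0} := by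
      ext l
      constructor
      · intro hl
        rcases (hbdd l hl).lt_or_eq with hlt | rfl
        · exact ⟨hlt, (canDecrypt_of_lt_iff hx hz h1 h2 hlt).1 hl⟩
        · exact absurd ((canDecrypt_current_iff hx hz h1 h2).1 hl) hc
      · intro hl
        exact (canDecrypt_of_lt_iff hx hz h1 h2 hl.1).2 hl.2
    rw [decryptedVersion, this]

end Path

end Gossip

namespace Gossip

/-! ### The time average of the version age of one realization -/

theorem runAge_nonneg {X E : Type*} {f : E → ℝ} (hf : ∀ y, 0 ≤ f y) (V : X → E) (θ : X → X)
    (l : ℕ) (x : X) : 0 ≤ runAge f V θ l x := by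
  induction l with
  | zero => exact le_rfl
  | succ l ih => exact add_nonneg zero_le_one (mul_nonneg ih (hf _))

theorem failed_nonneg {ι : Type*} [Fintype ι] (K : ℕ) (y : ℝ × (ι → ℝ)) : 0 ≤ failed K y := by
  unfold failed; split_ifs <;> simp

theorem failed_le_one {ι : Type*} [Fintype ι] (K : ℕ) (y : ℝ × (ι → ℝ)) : failed K y ≤ 1 := by
  unfold failed; split_ifs <;> simp

/-- If a monotone quantity is interlaced with a sequence that grows linearly, at times that grow
linearly, then it grows linearly. -/
theorem tendsto_div_of_interlaced {τ B : ℕ → ℝ} {A : ℝ → ℝ} {n : ℝ → ℕ} {b c : ℝ} (hc : 0 < c)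
    (hτ : Tendsto (fun l : ℕ => τ l / l) atTop (𝓝 c))
    (hB : Tendsto (fun l : ℕ => B l / l) atTop (𝓝 b)) (hB0 : ∀ l, 0 ≤ B l)
    (hn : Tendsto n atTop atTop)
    (h : ∀ᶠ t in atTop, (0 < τ (n t) ∧ τ (n t) ≤ t ∧ t < τ (n t + 1))
      ∧ B (n t) ≤ A t ∧ A t ≤ B (n t + 1)) :
    Tendsto (fun t => A t / t) atTop (𝓝 (b / c)) := by
  have hr : Tendsto (fun l : ℕ => ((l + 1 : ℕ) : ℝ) / l) atTop (𝓝 1) := by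
    have h1 : Tendsto (fun l : ℕ => 1 + 1 / (l : ℝ)) atTop (𝓝 (1 + 0)) :=
      tendsto_one_div_atTop_nhds_zero_nat.const_add 1
    rw [add_zero] at h1
    refine h1.congr' ?_
    filter_upwards [eventually_ge_atTop 1] with l hl
    have : (l : ℝ) ≠ 0 := Nat.cast_ne_zero.2 (by omega)
    push_cast; field_simp
  have shift : ∀ {f : ℕ → ℝ} {a : ℝ}, Tendsto (fun l : ℕ => f l / l) atTop (𝓝 a) →
      Tendsto (fun l : ℕ => f (l + 1) / l) atTop (𝓝 a) := by
    intro f a hf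
    have h1 := (hf.comp (tendsto_add_atTop_nat 1)).mul hr
    rw [mul_one] at h1
    refine h1.congr fun l => ?_
    have : ((l + 1 : ℕ) : ℝ) ≠ 0 := Nat.cast_ne_zero.2 (by omega)
    rw [Function.comp, div_mul_div_cancel₀ this]
  have hlow : Tendsto (fun l : ℕ => B l / τ (l + 1)) atTop (𝓝 (b / c)) := by
    refine (hB.div (shift hτ) hc.ne').congr' ?_
    filter_upwards [eventually_ge_atTop 1] with l hl
    have : (l : ℝ) ≠ 0 := Nat.cast_ne_zero.2 (by omega)
    rw [Pi.div_apply, div_div_div_cancel_right₀ this]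
  have hup : Tendsto (fun l : ℕ => B (l + 1) / τ l) atTop (𝓝 (b / c)) := by
    refine ((shift hB).div hτ hc.ne').congr' ?_
    filter_upwards [eventually_ge_atTop 1] with l hl
    have : (l : ℝ) ≠ 0 := Nat.cast_ne_zero.2 (by omega)
    rw [Pi.div_apply, div_div_div_cancel_right₀ this]
  refine tendsto_of_tendsto_of_tendsto_of_le_of_le' (hlow.comp hn) (hup.comp hn) ?_ ?_
  · filter_upwards [h] with t ht
    obtain ⟨⟨h0, h1, h2⟩, h3, h4⟩ := ht
    exact div_le_div₀ ((hB0 _).trans h3) h3 (h0.trans_le h1) h2.le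
  · filter_upwards [h] with t ht
    obtain ⟨⟨h0, h1, h2⟩, h3, h4⟩ := ht
    exact div_le_div₀ (hB0 _) h4 h0 h1

section Path

variable {m : ℕ} {x : Counter m → ℕ → ℝ} {S : Finset (Fin m)} {j : Fin m}
  {z : GapSpace (Provider S j)} (hx : HasGaps x S j z) (hz : IsRegular z)
include hx hz

/-- Inside the open epoch the age is a constant times the indicator of the translated waiting set;
the endpoints are negligible. -/
theorem versionAge_epoch (k L : ℕ) :
    IntervalIntegrable (versionAge x k S j) volume (epochStart z L) (epochStart z (L + 1)) ∧
    ∫ t in epochStart z L..epochStart z (L + 1), versionAge x k S j t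
      = runAge (failed (neededKeys k S j)) firstEpoch shift L z
        * waitTime (neededKeys k S j) (epoch z L) := by
  set a := runAge (failed (neededKeys k S j)) firstEpoch shift L z
  set K := neededKeys k S j with hK
  set y := epoch z L
  have hlt := hz.strictMono_epochStart (Nat.lt_succ_self L)
  have hW : MeasurableSet (waitSet K y) := measurable_prodMk_left (measurableSet_waitSet K)
  have hfin : volume (waitSet K y) ≠ ⊤ :=
    ne_top_of_le_ne_top ENNReal.ofReal_ne_top (volume_waitSet_le K y)
  let g0 : ℝ → ℝ := (waitSet K y).indicator fun _ => a
  let g : ℝ → ℝ := fun t => g0 (t - epochStart z L)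
  have hg0 : Integrable g0 := (integrable_indicator_iff hW).2 (integrableOn_const hfin)
  have hg : Integrable g := hg0.comp_sub_right (epochStart z L)
  have hy1 : y.1 = z.1 L := epoch_fst z L
  have hmem : ∀ t, t - epochStart z L ∈ waitSet K y → t ∈ Set.Ioo (epochStart z L)
      (epochStart z (L + 1)) := fun t ht => by
    have h1 := ht.1.1
    have h2 := ht.1.2
    rw [hy1] at h2
    rw [epochStart_succ]
    exact ⟨by linarith, by linarith⟩
  have heq : Set.EqOn g (versionAge x k S j) (Set.Ioo (epochStart z L) (epochStart z (L + 1))) := by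
    intro t ht
    rw [versionAge_eq hx hz ht.1.le ht.2]
    simp only [g, g0]
    have h1 : 0 < t - epochStart z L := sub_pos.2 ht.1
    have h2 : t - epochStart z L < y.1 := by
      have := ht.2
      rw [epochStart_succ] at this
      rw [hy1]; linarith
    split_ifs with hc
    · have hn : t - epochStart z L ∉ waitSet K y := fun h => absurd h.2 (not_lt.2 hc)
      exact Set.indicator_of_notMem hn _
    · have hn : t - epochStart z L ∈ waitSet K y := ⟨⟨h1, h2⟩, not_le.1 hc⟩
      exact Set.indicator_of_mem hn _
  constructor
  · rw [intervalIntegrable_iff_integrableOn_Ioo_of_le hlt.le]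
    exact hg.integrableOn.congr_fun heq measurableSet_Ioo
  · rw [intervalIntegral.integral_of_le hlt.le, integral_Ioc_eq_integral_Ioo,
      ← setIntegral_congr_fun measurableSet_Ioo heq,
      setIntegral_eq_integral_of_forall_compl_eq_zero]
    · rw [integral_sub_right_eq_self g0, integral_indicator hW, setIntegral_const, smul_eq_mul,
        mul_comm]
      rfl
    · intro t ht
      exact Set.indicator_of_notMem (fun h => ht (hmem t h)) _

theorem integral_versionAge_epochStart (k L : ℕ) :
    IntervalIntegrable (versionAge x k S j) volume 0 (epochStart z L) ∧
    ∫ t in 0..epochStart z L, versionAge x k S j t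
      = ∑ l ∈ Finset.range L, runAge (failed (neededKeys k S j)) firstEpoch shift l z
        * waitTime (neededKeys k S j) (epoch z l) := by
  have h := fun l => versionAge_epoch hx hz k l
  have h1 := IntervalIntegrable.trans_iterate (a := epochStart z) (n := L) fun l _ => (h l).1
  have h2 := intervalIntegral.sum_integral_adjacent_intervals (a := epochStart z) (n := L)
    fun l _ => (h l).1
  rw [epochStart_zero] at h1 h2
  exact ⟨h1, by rw [← h2]; exact Finset.sum_congr rfl fun l _ => (h l).2⟩

theorem versionAge_nonneg (k : ℕ) {t : ℝ} (ht : 0 ≤ t) : 0 ≤ versionAge x k S j t := by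
  obtain ⟨L, h1, h2⟩ := hz.exists_epoch ht
  rw [versionAge_eq hx hz h1 h2]
  split_ifs
  · exact le_rfl
  · exact runAge_nonneg (failed_nonneg _) _ _ _ _

/-- The integral of the nonnegative age is monotone in its upper limit, so at time t it lies between
its values at the two source updates enclosing t. The version number itself serves as the
interlacing index. -/
theorem timeAverage_versionAge (k : ℕ) {b c : ℝ} (hc : 0 < c)
    (hτ : Tendsto (fun L : ℕ => (∑ l ∈ Finset.range L, (epoch z l).1) / L) atTop (𝓝 c))
    (hb : Tendsto (fun L : ℕ => (∑ l ∈ Finset.range L,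
      runAge (failed (neededKeys k S j)) firstEpoch shift l z
        * waitTime (neededKeys k S j) (epoch z l)) / L) atTop (𝓝 b)) :
    (∀ t : ℝ, 0 ≤ t → IntervalIntegrable (versionAge x k S j) volume 0 t) ∧
    Tendsto (fun t : ℝ => (1 / t) * ∫ u in (0 : ℝ)..t, versionAge x k S j u) atTop
      (𝓝 (b / c)) := by
  have hmono := hz.strictMono_epochStart
  have hI : ∀ t : ℝ, 0 ≤ t → IntervalIntegrable (versionAge x k S j) volume 0 t := by
    intro t ht
    obtain ⟨L, h1, h2⟩ := hz.exists_epoch ht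
    refine (integral_versionAge_epochStart hx hz k (L + 1)).1.mono_set ?_
    rw [Set.uIcc_of_le ht, Set.uIcc_of_le (hz.epochStart_nonneg _)]
    exact Set.Icc_subset_Icc_right h2.le
  refine ⟨hI, ?_⟩
  have hle : ∀ {s t : ℝ}, 0 ≤ s → s ≤ t → ∫ u in (0 : ℝ)..s, versionAge x k S j u
      ≤ ∫ u in (0 : ℝ)..t, versionAge x k S j u := by
    intro s t hs hst
    refine intervalIntegral.integral_mono_interval le_rfl hs hst ?_ (hI t (hs.trans hst))
    exact (ae_restrict_iff' measurableSet_Ioc).2 (Eventually.of_forall fun u hu =>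
      versionAge_nonneg hx hz k hu.1.le)
  simp_rw [one_div, inv_mul_eq_div]
  refine tendsto_div_of_interlaced (τ := epochStart z)
    (B := fun L => ∫ u in (0 : ℝ)..epochStart z L, versionAge x k S j u)
    (n := fun t => sourceVersion x t) hc ?_ ?_ ?_ ?_ ?_
  · refine hτ.congr fun L => ?_
    simp_rw [epoch_fst]; rfl
  · refine hb.congr fun L => ?_
    rw [(integral_versionAge_epochStart hx hz k L).2]
  · intro L
    have := hle le_rfl (hz.epochStart_nonneg L)
    rwa [intervalIntegral.integral_same] at this
  · refine tendsto_atTop.2 fun L => ?_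
    filter_upwards [eventually_ge_atTop (epochStart z L)] with t ht
    obtain ⟨L', h1, h2⟩ := hz.exists_epoch ((hz.epochStart_nonneg L).trans ht)
    rw [sourceVersion_eq hx hz h1 h2]
    have := hmono.lt_iff_lt.1 (ht.trans_lt h2)
    omega
  -- From the first source update on, the index is at least 1, so the start of the current epoch is
  -- a positive denominator.
  · filter_upwards [eventually_ge_atTop (epochStart z 1)] with t ht
    have ht0 : 0 ≤ t := (hz.epochStart_nonneg 1).trans ht
    obtain ⟨L, h1, h2⟩ := hz.exists_epoch ht0
    rw [sourceVersion_eq hx hz h1 h2]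
    have hL : 0 < L := by
      have := hmono.lt_iff_lt.1 (ht.trans_lt h2)
      omega
    refine ⟨⟨?_, h1, h2⟩, hle (hz.epochStart_nonneg L) h1, hle ht0 h2.le⟩
    rw [← epochStart_zero z]
    exact hmono hL

end Path

/-! ### Almost all realizations -/

theorem ae_isRegular {ι : Type*} [Fintype ι] {lam μ : ℝ} [Fact (0 < lam)] [Fact (0 < μ)] :
    ∀ᵐ z ∂gapLaw ι lam μ, IsRegular z := by
  have h1 : ∀ᵐ z ∂gapLaw ι lam μ, (∀ n, 0 < z.1 n) ∧ ∀ u : ℝ, ∃ n, u ≤ arrival z.1 n :=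
    Measure.quasiMeasurePreserving_fst.ae
      (ae_pos_poissonLaw.and ae_exists_le_arrival)
  have h2 : ∀ᵐ z ∂gapLaw ι lam μ, ∀ e, IsLocallyFinite (z.2 e) := by
    refine ae_all_iff.2 fun e => ?_
    have h3 : ∀ᵐ h ∂Measure.pi (fun _ : ι => poissonLaw μ), IsLocallyFinite (h e) := by
      refine (Measure.quasiMeasurePreserving_eval (fun _ : ι => poissonLaw μ) e).ae (p := IsLocallyFinite) ?_
      filter_upwards [ae_pos_poissonLaw (μ := μ), ae_exists_le_arrival (μ := μ)] with h ha hb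
      exact ⟨fun n => (ha n).le, hb⟩
    exact Measure.quasiMeasurePreserving_snd.ae h3
  filter_upwards [h1, h2] with z ha hb
  exact ⟨ha.1, ha.2, hb⟩

/-- With success probability p the limit is ((1 - p) / lam / p) / (1 / lam) = 1/p - 1. The
realization `x` is quantified inside the almost sure statement, so the exceptional set depends on
the gaps alone and the result transfers to any probability space carrying the network. -/
theorem ae_timeAverage {m : ℕ} (S : Finset (Fin m)) (j : Fin m) (k : ℕ) {lam μ : ℝ}
    [hl : Fact (0 < lam)] [hμ : Fact (0 < μ)]
    (hK : neededKeys k S j ≤ Fintype.card (Provider S j)) :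
    ∀ᵐ z ∂gapLaw (Provider S j) lam μ, ∀ x, HasGaps x S j z →
    (∀ t : ℝ, 0 ≤ t → IntervalIntegrable (versionAge x k S j) volume 0 t) ∧
    Tendsto (fun t : ℝ => (1 / t) * ∫ u in (0 : ℝ)..t, versionAge x k S j u) atTop
      (𝓝 ((winProb lam μ (Fintype.card (Provider S j)) (neededKeys k S j))⁻¹ - 1)) := by
  set K := neededKeys k S j
  set N := Fintype.card (Provider S j)
  have hreg := isRegenerative_gapLaw (ι := Provider S j) (lam := lam) (μ := μ)
  have hp := winProb_pos hl.out hμ.out hK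
  have hq : ∫ z, failed K (firstEpoch z) ∂gapLaw (Provider S j) lam μ = 1 - winProb lam μ N K :=
    integral_failed hK
  have t1 := hreg.ae_tendsto_average (U := Prod.fst) measurable_fst memLp_firstEpoch_fst
  have t2 := hreg.ae_tendsto_average_runAge (measurable_failed K) (failed_nonneg K)
    (failed_le_one K) (by rw [hq]; linarith) (measurable_waitTime K) (memLp_waitTime K)
  rw [hq, integral_waitTime hK] at t2
  rw [integral_firstEpoch_fst] at t1
  filter_upwards [ae_isRegular (ι := Provider S j) (lam := lam) (μ := μ), t1, t2]
    with z hz h1 h2 x hx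
  have hl' : 0 < lam := hl.out
  have := timeAverage_versionAge hx hz k (one_div_pos.2 hl') h1 h2
  convert this using 3
  rw [sub_sub_cancel]
  field_simp
  rfl

end Gossip

namespace Gossip

/-! ### The law of the gaps in a scalable homogeneous network -/

theorem arrival_gap {Ω : Type*} (T : ℕ → Ω → ℝ) (r : ℕ) (ω : Ω) :
    T r ω = arrival (fun q => gap T q ω) r := by
  induction r with
  | zero => rw [arrival_zero]; rfl
  | succ r ih => rw [arrival_succ, ← ih, gap]; ring

/-- The gaps between the terms of a sequence. -/
def gapsOf (t : ℕ → ℝ) : ℕ → ℝ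
  | 0 => t 0
  | r + 1 => t (r + 1) - t r

theorem measurable_gapsOf : Measurable gapsOf := by
  refine measurable_pi_iff.2 fun r => ?_
  cases r with
  | zero => exact measurable_pi_apply 0
  | succ r => exact (measurable_pi_apply (r + 1)).sub (measurable_pi_apply r)

theorem gap_eq_gapsOf {Ω : Type*} (T : ℕ → Ω → ℝ) (ω : Ω) :
    (fun r => gap T r ω) = gapsOf fun r => T r ω := by
  funext r; cases r <;> rfl

section Law

variable {Ω : Type*} [MeasurableSpace Ω] {P : Measure Ω}

theorem IsPoissonCounter.measurable_gap {ρ : ℝ} {T : ℕ → Ω → ℝ} (h : IsPoissonCounter P ρ T)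
    (r : ℕ) : Measurable (gap T r) := by
  cases r with
  | zero => exact h.measurable 0
  | succ r => exact (h.measurable (r + 1)).sub (h.measurable r)

theorem IsPoissonCounter.map_gap {ρ : ℝ} {T : ℕ → Ω → ℝ} (h : IsPoissonCounter P ρ T) :
    P.map (fun ω r => gap T r ω) = poissonLaw ρ := by
  rw [h.indep.map_fun_eq_infinitePi_map h.measurable_gap, poissonLaw]
  congr 1
  exact funext h.law

variable [IsProbabilityMeasure P]

/-- Independent variables indexed by `Option ι`, the last `ι` of which have the same law. -/
theorem map_option_eq_prod {ι β : Type*} [Fintype ι] [MeasurableSpace β] {Z : Option ι → Ω → β}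
    (hZ : ∀ c, Measurable (Z c)) (hi : iIndepFun Z P) {ν0 ν1 : Measure β}
    (h0 : P.map (Z none) = ν0) (h1 : ∀ e, P.map (Z (some e)) = ν1) :
    P.map (fun ω => (Z none ω, fun e => Z (some e) ω)) = ν0.prod (Measure.pi fun _ : ι => ν1) := by
  have hprob : ∀ c, IsProbabilityMeasure (P.map (Z c)) := fun c =>
    Measure.isProbabilityMeasure_map (hZ c).aemeasurable
  have h := (iIndepFun_iff_map_fun_eq_pi_map fun c => (hZ c).aemeasurable).1 hi
  rw [← Measure.pi_map_piOptionEquivProd] at h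
  have hψ : Measurable fun f : Option ι → β => (f none, fun e => f (some e)) := by fun_prop
  have h2 := congrArg (fun ρ => ρ.map fun f : Option ι → β => (f none, fun e => f (some e))) h
  simp_rw [h1, h0] at h2
  have : SFinite ν0 := by rw [← h0]; infer_instance
  have : SFinite (Measure.pi fun _ : ι => ν1) := by
    have : (fun _ : ι => ν1) = fun e => P.map (Z (some e)) := funext fun e => (h1 e).symm
    rw [this]; infer_instance
  rw [Measure.map_map hψ (measurable_pi_iff.2 hZ),
    Measure.map_map hψ (MeasurableEquiv.measurable _)] at h2
  rw [← Measure.prod_swap]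
  exact h2

variable {m : ℕ} {lamS lamE μ : ℝ} {T : Counter m → ℕ → Ω → ℝ}

/-- The age of `j` involves only the source and the edges from providers into `j`. These counters
form a subfamily along an injection, so they inherit independence. -/
theorem IsSHN.map_gaps (hT : IsSHN P m lamS lamE T) (S : Finset (Fin m)) (j : Fin m)
    (hrate : ∀ e, rate m lamS lamE (some e) = μ) :
    P.map (fun ω => ((fun r => gap (T none) r ω, fun (e : Provider S j) r =>
      gap (T (some ⟨(e.1, j), e.2.2⟩)) r ω) : GapSpace (Provider S j)))
      = gapLaw (Provider S j) lamS μ := by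
  let f : Option (Provider S j) → Counter m := Option.map fun e => ⟨(e.1, j), e.2.2⟩
  have hf : Function.Injective f := Option.map_injective fun e e' h => by
    simp only [Subtype.mk.injEq, Prod.mk.injEq, and_true] at h
    exact Subtype.ext h
  have hi : iIndepFun (fun (c : Counter m) (ω : Ω) (r : ℕ) => gap (T c) r ω) P := by
    have e : (fun (c : Counter m) (ω : Ω) (r : ℕ) => gap (T c) r ω)
        = fun c => gapsOf ∘ fun ω r => T c r ω := by
      funext c ω; exact gap_eq_gapsOf _ _
    rw [e]
    exact hT.indep.comp (fun _ => gapsOf) fun _ => measurable_gapsOf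
  refine map_option_eq_prod (Z := fun c ω r => gap (T (f c)) r ω)
    (fun c => measurable_pi_iff.2 fun r => (hT.poisson (f c)).measurable_gap r) (hi.precomp hf)
    (hT.poisson none).map_gap fun e => ?_
  have := (hT.poisson (f (some e))).map_gap
  rwa [show rate m lamS lamE (f (some e)) = μ from hrate _] at this

theorem IsSHN.hasTimeAverageAge [Fact (0 < lamS)] [Fact (0 < μ)] (hT : IsSHN P m lamS lamE T)
    (S : Finset (Fin m)) (j : Fin m) (k : ℕ) (hrate : ∀ e, rate m lamS lamE (some e) = μ)
    (hK : neededKeys k S j ≤ Fintype.card (Provider S j)) :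
    HasTimeAverageAge P T k S j
      ((winProb lamS μ (Fintype.card (Provider S j)) (neededKeys k S j))⁻¹ - 1) := by
  have h := ae_timeAverage (lam := lamS) (μ := μ) S j k hK
  rw [← hT.map_gaps S j hrate] at h
  have hm : Measurable fun ω => ((fun r => gap (T none) r ω, fun (e : Provider S j) r =>
      gap (T (some ⟨(e.1, j), e.2.2⟩)) r ω) : GapSpace (Provider S j)) := by
    refine Measurable.prodMk (measurable_pi_iff.2 fun r => (hT.poisson none).measurable_gap r) ?_
    exact measurable_pi_iff.2 fun e => measurable_pi_iff.2 fun r =>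
      (hT.poisson _).measurable_gap r
  filter_upwards [ae_of_ae_map hm.aemeasurable h] with ω hω
  exact hω _ ⟨fun r => arrival_gap (T none) r ω, fun e r => arrival_gap _ r ω⟩

end Law

theorem card_provider {m : ℕ} (S : Finset (Fin m)) (j : Fin m) :
    Fintype.card (Provider S j) = (S.erase j).card := by
  rw [Fintype.card_subtype]
  congr 1; ext i; simp [and_comm]

/-! ### The limit for large networks -/

/-- The reciprocal is a product of a fixed number of factors 1 + lamS (m - 1) / (lamE (N m - i)),
and each converges because m / N m → 1 / α while the shifts by 1 and i are negligible. -/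
theorem tendsto_winProb_inv {lamS lamE α : ℝ} (hα : 0 < α) {N : ℕ → ℕ}
    (hN : Tendsto (fun m : ℕ => (N m : ℝ) / m) atTop (𝓝 α)) (K : ℕ) :
    Tendsto (fun m : ℕ => (winProb lamS (lamE / ((m : ℝ) - 1)) (N m) K)⁻¹) atTop
      (𝓝 ((1 + lamS / (α * lamE)) ^ K)) := by
  simp_rw [winProb, Finset.prod_inv_distrib, inv_inv]
  rw [← Finset.card_range K, ← Finset.prod_const, Finset.card_range]
  refine tendsto_finsetProd _ fun i _ => Tendsto.const_add 1 ?_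
  have h1 : Tendsto (fun m : ℕ => 1 - 1 / (m : ℝ)) atTop (𝓝 (1 - 0)) :=
    tendsto_one_div_atTop_nhds_zero_nat.const_sub 1
  have h2 : Tendsto (fun m : ℕ => (N m : ℝ) / m - i / (m : ℝ)) atTop (𝓝 (α - 0)) :=
    hN.sub (tendsto_const_div_atTop_nhds_zero_nat (i : ℝ))
  have h3 := (h1.div h2 (by simpa using hα.ne')).const_mul (lamS / lamE)
  have e : lamS / lamE * ((1 - 0) / (α - 0)) = lamS / (α * lamE) := by
    rw [sub_zero, sub_zero, div_mul_div_comm, mul_one, mul_comm lamE]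
  rw [e] at h3
  refine h3.congr' ?_
  filter_upwards [eventually_ge_atTop 1] with m hm
  have hm' : (m : ℝ) ≠ 0 := Nat.cast_ne_zero.2 (by omega)
  have e1 : (1 - 1 / (m : ℝ)) / ((N m : ℝ) / m - i / (m : ℝ)) = ((m : ℝ) - 1) / (N m - i) := by
    rw [← sub_div, ← div_self hm', ← sub_div, div_div_div_cancel_right₀ hm']
  rw [Pi.div_apply, e1, div_mul_div_comm, div_mul_eq_mul_div, div_div_eq_mul_div]

end Gossip

/-! ### The constants for each network size and the limit of the graph average. -/

theorem mainTheorem8 (k : ℕ) (lamS lamE α : ℝ) (hS : 0 < lamS) (hE : 0 < lamE)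
    (hα : 0 < α) (hα' : α ≤ 1) :
    ∃ dSub dNon : ℕ → ℝ,
      (∀ m : ℕ, k < ⌊α * (m : ℝ)⌋₊ →
        ∀ (Ω : Type*) [MeasurableSpace Ω] (P : Measure Ω) [IsProbabilityMeasure P]
          (T : Gossip.Counter m → ℕ → Ω → ℝ), Gossip.IsSHN P m lamS lamE T →
        ∀ S : Finset (Fin m), S.card = ⌊α * (m : ℝ)⌋₊ →
          (∀ j ∈ S, Gossip.HasTimeAverageAge P T k S j (dSub m)) ∧
          (∀ j ∉ S, Gossip.HasTimeAverageAge P T k S j (dNon m))) ∧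
      Tendsto (fun m : ℕ => Gossip.graphAverage m ⌊α * (m : ℝ)⌋₊ (dSub m) (dNon m)) atTop
        (𝓝 ((1 + lamS / (α * lamE)) ^ k * ((lamS + α * (lamE - lamS)) / (α * lamE)) - 1)) := by
  -- A subscriber has one provider fewer, since it does not send to itself, and needs one key fewer.
  refine ⟨fun m => (Gossip.winProb lamS (lamE / ((m : ℝ) - 1)) (⌊α * (m : ℝ)⌋₊ - 1) k)⁻¹ - 1,
    fun m => (Gossip.winProb lamS (lamE / ((m : ℝ) - 1)) ⌊α * (m : ℝ)⌋₊ (k + 1))⁻¹ - 1, ?_, ?_⟩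
  · intro m hm Ω _ P _ T hT S hcard
    have : Fact (0 < lamS) := ⟨hS⟩
    rcases lt_trichotomy m 1 with h0 | rfl | h1
    · obtain rfl : m = 0 := by omega
      simp at hm
    · have hn : ⌊α * ((1 : ℕ) : ℝ)⌋₊ ≤ 1 := by
        rw [Nat.cast_one, mul_one]; exact Nat.floor_le_of_le (by simpa using hα')
      obtain rfl : k = 0 := by omega
      have hS1 : S.card = Fintype.card (Fin 1) := by rw [Fintype.card_fin]; omega
      have hSu : S = Finset.univ := (Finset.card_eq_iff_eq_univ S).1 hS1
      -- For m = 1 the nominal edge rate is `lamE / 0 = 0`, but there are no edges, so any positive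
      -- rate may be used. No key is needed from others, and the empty product in `winProb` does not
      -- see the rate.
      have : Fact ((0 : ℝ) < 1) := ⟨one_pos⟩
      refine ⟨fun j hj => ?_, fun j hj => absurd (hSu ▸ Finset.mem_univ j) hj⟩
      have hrate : ∀ e : Gossip.Edge 1, Gossip.rate 1 lamS lamE (some e) = 1 := fun e =>
        absurd (Subsingleton.elim _ _) e.2
      have hneed : Gossip.neededKeys 0 S j = 0 := if_pos hj
      have h := hT.hasTimeAverageAge S j 0 hrate (by rw [hneed]; exact Nat.zero_le _)
      rw [hneed] at h
      simpa only [Gossip.winProb, Finset.range_zero, Finset.prod_empty] using h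
    · have hm1 : (0 : ℝ) < (m : ℝ) - 1 := by
        have : (1 : ℝ) < m := by exact_mod_cast h1
        linarith
      have : Fact (0 < lamE / ((m : ℝ) - 1)) := ⟨div_pos hE hm1⟩
      have hrate : ∀ e : Gossip.Edge m,
          Gossip.rate m lamS lamE (some e) = lamE / ((m : ℝ) - 1) := fun _ => rfl
      refine ⟨fun j hj => ?_, fun j hj => ?_⟩
      · have hneed : Gossip.neededKeys k S j = k := if_pos hj
        have hc : Fintype.card (Gossip.Provider S j) = ⌊α * (m : ℝ)⌋₊ - 1 := by
          rw [Gossip.card_provider, Finset.card_erase_of_mem hj, hcard]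
        have h := hT.hasTimeAverageAge S j k hrate (by rw [hneed, hc]; omega)
        rwa [hneed, hc] at h
      · have hneed : Gossip.neededKeys k S j = k + 1 := if_neg hj
        have hc : Fintype.card (Gossip.Provider S j) = ⌊α * (m : ℝ)⌋₊ := by
          rw [Gossip.card_provider, Finset.erase_eq_of_notMem hj, hcard]
        have h := hT.hasTimeAverageAge S j k hrate (by rw [hneed, hc]; omega)
        rwa [hneed, hc] at h
  · have hn : Tendsto (fun m : ℕ => (⌊α * (m : ℝ)⌋₊ : ℝ) / m) atTop (𝓝 α) :=
      (tendsto_nat_floor_mul_div_atTop hα.le).comp tendsto_natCast_atTop_atTop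
    -- The subtraction is truncated, so it matches the real one only once the floor is at least 1,
    -- which holds for large m.
    have hn1 : Tendsto (fun m : ℕ => ((⌊α * (m : ℝ)⌋₊ - 1 : ℕ) : ℝ) / m) atTop (𝓝 α) := by
      have h1 := hn.sub (tendsto_one_div_atTop_nhds_zero_nat (𝕜 := ℝ))
      rw [sub_zero] at h1
      refine h1.congr' ?_
      filter_upwards [(tendsto_natCast_atTop_atTop.const_mul_atTop hα).eventually_ge_atTop 1]
        with m hm
      rw [Nat.cast_sub (Nat.le_floor (by simpa using hm)), Nat.cast_one, sub_div]
    have h1 := (hn.mul ((Gossip.tendsto_winProb_inv (lamS := lamS) (lamE := lamE) hα hn1 k).sub_const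
      1)).add ((hn.const_sub 1).mul ((Gossip.tendsto_winProb_inv (lamS := lamS) (lamE := lamE) hα hn
      (k + 1)).sub_const 1))
    have e : α * ((1 + lamS / (α * lamE)) ^ k - 1)
        + (1 - α) * ((1 + lamS / (α * lamE)) ^ (k + 1) - 1)
        = (1 + lamS / (α * lamE)) ^ k * ((lamS + α * (lamE - lamS)) / (α * lamE)) - 1 := by
      have e1 : (lamS + α * (lamE - lamS)) / (α * lamE)
          = α + (1 - α) * (1 + lamS / (α * lamE)) := by field_simp; ring
      rw [e1, pow_succ]; ring
    rw [e] at h1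
    refine h1.congr' ?_
    filter_upwards [eventually_ge_atTop 1] with m hm
    have hm' : (m : ℝ) ≠ 0 := Nat.cast_ne_zero.2 (by omega)
    rw [Gossip.graphAverage, sub_div, div_self hm']
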